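/- For complex $a,q$ with $|q|<1$ write $(a;q)_n=\prod_{j=0}^{n-1}(1-aq^j)$, $(a;q)_\infty=\prod_{j=0}^{\infty}(1-aq^j)$, and $(a_1,\dots,a_k;q)_n=(a_1;q)_n\cdots(a_k;q)_n$, also for $n=\infty$. Let $q\in\mathbb{C}$ with $|q|<1$. Then the following five identities hold, all the series being absolutely convergent. For every complex $b\neq 0$, $$\sum_{n=0}^{\infty}\frac{(b,q^3/b;q)_n\,q^{n(n+1)/2}}{(q^2;q^2)_{n+1}(q;q)_n}=\frac{(q^4/b,bq;q^2)_\infty}{(q;q)_\infty};$$ $$\sum_{n=0}^{\infty}\frac{(1-q^{2n+1})(-q^3;q^2)_n\,q^{n^2}}{(q^2;q^2)_n}=\frac{1}{(q^3,q^4,q^5;q^8)_\infty};$$ if $q\neq 0$, $$\sum_{n=0}^{\infty}\frac{(1-q^{2n-1})(-q^3;q^2)_n\,q^{n^2-2n}}{(q^2;q^2)_n}=\frac{1}{(q,q^4,q^7;q^8)_\infty};$$ $$1+\sum_{n=1}^{\infty}\frac{(-q;q)_n\,q^{(n^2-n)/2}}{(q;q)_{n-1}}=\frac{(-1;q)_\infty(-q^6,-q^{10},q^{16};q^{16})_\infty}{(q^4;q^4)_\infty};$$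 $$-1+\sum_{n=1}^{\infty}\frac{(-q;q)_n\,q^{(n^2-n)/2}}{(q;q)_{n-1}}=q\,\frac{(-1;q)_\infty(-q^2,-q^{14},q^{16};q^{16})_\infty}{(q^4;q^4)_\infty}.$$ -/

import Mathlib

/-- The finite `q`-shifted factorial `(a; q)_n = ∏_{0 ≤ j < n} (1 - a q^j)`. -/
noncomputable def qPoch (a q : ℂ) (n : ℕ) : ℂ :=
  ∏ j ∈ Finset.range n, (1 - a * q ^ j)

/-- The infinite `q`-shifted factorial `(a; q)_∞ = ∏_{j ≥ 0} (1 - a q^j)`. -/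
noncomputable def qPochInf (a q : ℂ) : ℂ :=
  ∏' j : ℕ, (1 - a * q ^ j)

/-- For `|q| < 1` the product defining `(a; q)_∞` converges, whatever `a` is, so that
`qPochInf a q` is the limit of the finite products. -/
theorem qPoch_tendsto_qPochInf (a : ℂ) {q : ℂ} (hq : ‖q‖ < 1) :
    Filter.Tendsto (qPoch a q) Filter.atTop (nhds (qPochInf a q)) := by
  have hs : Summable fun j : ℕ => ‖-(a * q ^ j)‖ := by
    simpa [norm_mul, norm_pow] using
      (summable_geometric_of_lt_one (norm_nonneg q) hq).mul_left ‖a‖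
  have hm : Multipliable fun j : ℕ => (1 - a * q ^ j) := by
    simpa [sub_eq_add_neg] using multipliable_one_add_of_summable hs
  exact hm.hasProd.tendsto_prod_nat

open Filter Topology

/-! ### The `q`-shifted factorials -/

/-! Three mechanisms carry the five identities.

Gauss: with denominators cleared, let G(a,b) be the sum of `gaussTerm`. Telescoping gives G(a,b) =
(1 - aq) G(aq²,b); iterating and using the symmetry in a, b reduces G to G(0,0), which Euler's
identity evaluates (`hasSum_gaussTerm`). Taking ab = q³ gives the first identity. Taking a = -q², b
= 0 gives S = (-q;q)_∞(-q;q²)_∞ for the series S of the last two.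

Theta: write A and qB for the two right-hand sides there. Splitting Ramanujan's f(q,q³) by parity
with the Jacobi triple product gives A + qB = 2S. Replacing q by -q in the splitting gives A - qB =
2. Hence A = S + 1 and qB = S - 1.

Göllnitz–Gordon: the sum of `gordonTerm q (-q) z` satisfies a second-order recurrence in z → zq²,
and the sum of `wellPoisedTerm` satisfies it too along z = q^(2k). Both tend to 1 as k → ∞, so they
agree (`eq_zero_of_gordon_recurrence`). At z = 1 and z = q² the well-poised series is a theta
series, hence a product. `tsum_gordonTerm_sub` converts these values into the two required series.
-/

@[simp] theorem qPoch_zero_right (a q : ℂ) : qPoch a q 0 = 1 := by simp [qPoch]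

theorem qPoch_succ (a q : ℂ) (n : ℕ) : qPoch a q (n + 1) = qPoch a q n * (1 - a * q ^ n) :=
  Finset.prod_range_succ _ _

theorem qPoch_succ_left (a q : ℂ) (n : ℕ) :
    qPoch a q (n + 1) = (1 - a) * qPoch (a * q) q n := by
  simp only [qPoch, Finset.prod_range_succ', pow_zero, mul_one]
  rw [mul_comm]
  congr 1
  exact Finset.prod_congr rfl fun j _ => by ring

theorem qPoch_add (a q : ℂ) (m n : ℕ) :
    qPoch a q (m + n) = qPoch a q m * qPoch (a * q ^ m) q n := by
  simp only [qPoch, Finset.prod_range_add]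
  congr 1
  exact Finset.prod_congr rfl fun j _ => by ring

@[simp] theorem qPoch_zero_left (q : ℂ) (n : ℕ) : qPoch 0 q n = 1 := by simp [qPoch]

@[simp] theorem qPochInf_zero_left (q : ℂ) : qPochInf 0 q = 1 := by simp [qPochInf]

/-- The bound is independent of `n` and tends to 0 with `a`. It thus supplies both the dominating
constants and the limits of products along a qᵏ. -/
theorem norm_qPoch_sub_one_le (a : ℂ) {q : ℂ} (hq : ‖q‖ < 1) (n : ℕ) :
    ‖qPoch a q n - 1‖ ≤ Real.exp (‖a‖ / (1 - ‖q‖)) - 1 := by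
  have h := (Finset.range n).norm_prod_one_add_sub_one_le fun j => -(a * q ^ j)
  simp only [← sub_eq_add_neg] at h
  refine h.trans (sub_le_sub_right (Real.exp_le_exp.2 ?_) 1)
  simp only [norm_neg, norm_mul, norm_pow]
  rw [← Finset.mul_sum, div_eq_mul_inv]
  refine mul_le_mul_of_nonneg_left ?_ (norm_nonneg a)
  rw [← tsum_geometric_of_lt_one (norm_nonneg q) hq]
  exact (summable_geometric_of_lt_one (norm_nonneg q) hq).sum_le_tsum _
    fun _ _ => pow_nonneg (norm_nonneg q) _

theorem norm_qPochInf_sub_one_le (a : ℂ) {q : ℂ} (hq : ‖q‖ < 1) :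
    ‖qPochInf a q - 1‖ ≤ Real.exp (‖a‖ / (1 - ‖q‖)) - 1 :=
  le_of_tendsto ((qPoch_tendsto_qPochInf a hq).sub_const 1).norm
    (Eventually.of_forall fun n => norm_qPoch_sub_one_le a hq n)

theorem norm_le_of_norm_sub_one_le {z : ℂ} {c : ℝ} (h : ‖z - 1‖ ≤ c - 1) : ‖z‖ ≤ c := by
  have := norm_add_le (z - 1) 1
  simp only [sub_add_cancel, norm_one] at this
  linarith

theorem norm_qPoch_le {a q : ℂ} (hq : ‖q‖ < 1) {r : ℝ} (ha : ‖a‖ ≤ r) (n : ℕ) :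
    ‖qPoch a q n‖ ≤ Real.exp (r / (1 - ‖q‖)) :=
  (norm_le_of_norm_sub_one_le (norm_qPoch_sub_one_le a hq n)).trans <|
    Real.exp_le_exp.2 <| div_le_div_of_nonneg_right ha (by linarith)

theorem norm_qPochInf_le {a q : ℂ} (hq : ‖q‖ < 1) {r : ℝ} (ha : ‖a‖ ≤ r) :
    ‖qPochInf a q‖ ≤ Real.exp (r / (1 - ‖q‖)) :=
  (norm_le_of_norm_sub_one_le (norm_qPochInf_sub_one_le a hq)).trans <|
    Real.exp_le_exp.2 <| div_le_div_of_nonneg_right ha (by linarith)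

theorem qPochInf_eq_qPoch_mul (a : ℂ) {q : ℂ} (hq : ‖q‖ < 1) (n : ℕ) :
    qPochInf a q = qPoch a q n * qPochInf (a * q ^ n) q := by
  have h := ((tendsto_add_atTop_iff_nat n).2 (qPoch_tendsto_qPochInf a hq))
  refine tendsto_nhds_unique h ?_
  simp_rw [add_comm _ n, qPoch_add]
  exact (qPoch_tendsto_qPochInf _ hq).const_mul _

theorem qPochInf_eq_mul (a : ℂ) {q : ℂ} (hq : ‖q‖ < 1) :
    qPochInf a q = (1 - a) * qPochInf (a * q) q := by
  simpa [qPoch] using qPochInf_eq_qPoch_mul a hq 1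

theorem tendsto_qPochInf_one {ι : Type*} {l : Filter ι} {u : ι → ℂ} {q : ℂ} (hq : ‖q‖ < 1)
    (hu : Tendsto u l (𝓝 0)) : Tendsto (fun i => qPochInf (u i) q) l (𝓝 1) := by
  rw [tendsto_iff_norm_sub_tendsto_zero]
  refine squeeze_zero (fun _ => norm_nonneg _) (fun i => norm_qPochInf_sub_one_le (u i) hq) ?_
  have : Tendsto (fun i => Real.exp (‖u i‖ / (1 - ‖q‖)) - 1) l
      (𝓝 (Real.exp (‖(0 : ℂ)‖ / (1 - ‖q‖)) - 1)) :=
    ((Real.continuous_exp.tendsto _).comp (hu.norm.div_const _)).sub_const 1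
  simpa using this

theorem tendsto_qPoch_one {ι : Type*} {l : Filter ι} {u : ι → ℂ} (q : ℂ) (n : ℕ)
    (hu : Tendsto u l (𝓝 0)) : Tendsto (fun i => qPoch (u i) q n) l (𝓝 1) := by
  have : Tendsto (fun i => qPoch (u i) q n) l (𝓝 (∏ j ∈ Finset.range n, (1 - 0 * q ^ j))) :=
    tendsto_finsetProd _ fun j _ => (hu.mul_const _).const_sub 1
  simpa using this

theorem tendsto_mul_pow_zero (a : ℂ) {q : ℂ} (hq : ‖q‖ < 1) :
    Tendsto (fun n : ℕ => a * q ^ n) atTop (𝓝 0) := by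
  simpa using (tendsto_pow_atTop_nhds_zero_of_norm_lt_one hq).const_mul a

theorem qPochInf_ne_zero {a q : ℂ} (hq : ‖q‖ < 1) (h : ∀ n : ℕ, a * q ^ n ≠ 1) :
    qPochInf a q ≠ 0 := by
  have h1 := tendsto_qPochInf_one hq (tendsto_mul_pow_zero a hq)
  -- A tail close to 1 is nonzero, so only finitely many factors remain to be checked.
  obtain ⟨n, hn⟩ := (h1.eventually_ne one_ne_zero).exists
  rw [qPochInf_eq_qPoch_mul a hq n]
  refine mul_ne_zero (Finset.prod_ne_zero_iff.2 fun j _ => ?_) hn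
  exact sub_ne_zero.2 (h j).symm

theorem qPochInf_ne_zero_of_norm_lt {a q : ℂ} (hq : ‖q‖ < 1) (ha : ‖a‖ < 1) :
    qPochInf a q ≠ 0 := by
  refine qPochInf_ne_zero hq fun n h => ?_
  have h1 : ‖a * q ^ n‖ < 1 := by
    rw [norm_mul, norm_pow]
    exact (mul_le_of_le_one_right (norm_nonneg a)
      (pow_le_one₀ (norm_nonneg q) hq.le)).trans_lt ha
  simp [h] at h1

theorem qPoch_ne_zero_of_norm_lt {a q : ℂ} (hq : ‖q‖ < 1) (ha : ‖a‖ < 1) (n : ℕ) :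
    qPoch a q n ≠ 0 :=
  left_ne_zero_of_mul (qPochInf_eq_qPoch_mul a hq n ▸ qPochInf_ne_zero_of_norm_lt hq ha)

theorem exists_norm_le_of_tendsto {u : ℕ → ℂ} {l : ℂ} (h : Tendsto u atTop (𝓝 l)) :
    ∃ C : ℝ, 0 < C ∧ ∀ n, ‖u n‖ ≤ C := by
  obtain ⟨C, hC, h⟩ := (Metric.isBounded_range_of_tendsto u h).exists_pos_norm_le
  exact ⟨C, hC, fun n => h _ ⟨n, rfl⟩⟩

theorem exists_norm_inv_qPoch_le {a q : ℂ} (hq : ‖q‖ < 1) (ha : ‖a‖ < 1) :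
    ∃ C : ℝ, 0 < C ∧ ∀ n, ‖(qPoch a q n)⁻¹‖ ≤ C :=
  exists_norm_le_of_tendsto
    ((qPoch_tendsto_qPochInf a hq).inv₀ (qPochInf_ne_zero_of_norm_lt hq ha))

theorem exists_norm_inv_qPochInf_le (a : ℂ) {q : ℂ} (hq : ‖q‖ < 1) :
    ∃ C : ℝ, 0 < C ∧ ∀ n : ℕ, ‖(qPochInf (a * q ^ n) q)⁻¹‖ ≤ C :=
  exists_norm_le_of_tendsto
    ((tendsto_qPochInf_one hq (tendsto_mul_pow_zero a hq)).inv₀ one_ne_zero)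

/-- A function with `e x = (1 - x s) e(x q)` is `(x s; q)_∞` times its limit along `x qᵏ`. -/
theorem eq_qPochInf_mul_of_functional_eq {e : ℂ → ℂ} {q s x L : ℂ} (hq : ‖q‖ < 1)
    (he : ∀ y, e y = (1 - y * s) * e (y * q))
    (hL : Tendsto (fun k : ℕ => e (x * q ^ k)) atTop (𝓝 L)) :
    e x = qPochInf (x * s) q * L := by
  have h : ∀ k : ℕ, e x = qPoch (x * s) q k * e (x * q ^ k) := by
    intro k
    induction k with
    | zero => simp
    | succ k ih =>
      rw [ih, he (x * q ^ k), qPoch_succ]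
      ring_nf
  refine tendsto_nhds_unique (tendsto_const_nhds (f := (atTop : Filter ℕ))) ?_
  rw [funext h]
  exact (qPoch_tendsto_qPochInf _ hq).mul hL

theorem qPochInf_dissect (a : ℂ) {q : ℂ} (hq : ‖q‖ < 1) :
    qPochInf a q = qPochInf a (q ^ 2) * qPochInf (a * q) (q ^ 2) := by
  have hq2 : ‖q ^ 2‖ < 1 := by
    rw [norm_pow]; exact pow_lt_one₀ (norm_nonneg q) hq two_ne_zero
  have h : ∀ n, qPoch a q (2 * n) = qPoch a (q ^ 2) n * qPoch (a * q) (q ^ 2) n := by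
    intro n
    induction n with
    | zero => simp
    | succ n ih =>
      rw [mul_add, mul_one, qPoch_succ, qPoch_succ, ih, qPoch_succ, qPoch_succ]
      ring
  have h2 : Tendsto (fun n : ℕ => 2 * n) atTop atTop :=
    tendsto_id.const_mul_atTop' two_pos
  refine tendsto_nhds_unique ((qPoch_tendsto_qPochInf a hq).comp h2) ?_
  simp only [Function.comp_def, h]
  exact (qPoch_tendsto_qPochInf _ hq2).mul (qPoch_tendsto_qPochInf _ hq2)

theorem qPochInf_mul_qPochInf_neg (a : ℂ) {q : ℂ} (hq : ‖q‖ < 1) :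
    qPochInf a q * qPochInf (-a) q = qPochInf (a ^ 2) (q ^ 2) := by
  have hq2 : ‖q ^ 2‖ < 1 := by
    rw [norm_pow]; exact pow_lt_one₀ (norm_nonneg q) hq two_ne_zero
  refine tendsto_nhds_unique
    ((qPoch_tendsto_qPochInf a hq).mul (qPoch_tendsto_qPochInf (-a) hq)) ?_
  convert! qPoch_tendsto_qPochInf (a ^ 2) hq2 using 2 with n
  simp only [qPoch, ← Finset.prod_mul_distrib]
  exact Finset.prod_congr rfl fun j _ => by ring

/-! ### Summability of Gaussian sequences -/

theorem choose_succ_two (n : ℕ) : (n + 1).choose 2 = n + n.choose 2 := by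
  simp [Nat.choose_succ_succ' n 1]

theorem summable_pow_mul_pow_choose (x : ℝ) {r : ℝ} (hr0 : 0 ≤ r) (hr : r < 1) :
    Summable fun n : ℕ => x ^ n * r ^ n.choose 2 := by
  have h0 : Tendsto (fun n : ℕ => |x| * r ^ n) atTop (𝓝 0) := by
    simpa using (tendsto_pow_atTop_nhds_zero_of_lt_one hr0 hr).const_mul |x|
  refine summable_of_ratio_norm_eventually_le (r := 1 / 2) (by norm_num) ?_
  filter_upwards [h0.eventually_le_const (show (0 : ℝ) < 1 / 2 by norm_num)] with n hn
  have : x ^ (n + 1) * r ^ (n + 1).choose 2 = x * r ^ n * (x ^ n * r ^ n.choose 2) := by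
    rw [choose_succ_two]
    ring
  rw [this, norm_mul]
  refine mul_le_mul_of_nonneg_right ?_ (norm_nonneg _)
  rwa [norm_mul, Real.norm_eq_abs, Real.norm_of_nonneg (pow_nonneg hr0 n)]

theorem two_mul_choose_two (n : ℕ) : 2 * n.choose 2 + n = n ^ 2 := by
  induction n with
  | zero => simp
  | succ n ih => rw [choose_succ_two]; linarith [(by ring : (n + 1) ^ 2 = n ^ 2 + 2 * n + 1)]

theorem norm_pow_lt_one {q : ℂ} (hq : ‖q‖ < 1) {n : ℕ} (hn : n ≠ 0) : ‖q ^ n‖ < 1 := by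
  rw [norm_pow]; exact pow_lt_one₀ (norm_nonneg q) hq hn

theorem norm_pow_le_one {q : ℂ} (hq : ‖q‖ < 1) (n : ℕ) : ‖q ^ n‖ ≤ 1 := by
  rw [norm_pow]; exact pow_le_one₀ (norm_nonneg q) hq.le

/-! ### Euler's identity -/

/-- `∑ xⁿ q^(n choose 2) / (q; q)_n = (-x; q)_∞`. -/
theorem hasSum_euler (x : ℂ) {q : ℂ} (hq : ‖q‖ < 1) :
    HasSum (fun n : ℕ => x ^ n * q ^ n.choose 2 / qPoch q q n) (qPochInf (-x) q) := by
  obtain ⟨C, hC, hCb⟩ := exists_norm_inv_qPoch_le hq hq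
  have hbound : ∀ (R : ℝ) (y : ℂ), ‖y‖ ≤ R → ∀ n : ℕ,
      ‖y ^ n * q ^ n.choose 2 / qPoch q q n‖ ≤ R ^ n * ‖q‖ ^ n.choose 2 * C := by
    intro R y hy n
    rw [div_eq_mul_inv, norm_mul, norm_mul, norm_pow, norm_pow]
    gcongr
    · have := (norm_nonneg y).trans hy
      positivity
    · exact hCb n
  have hsumb : ∀ R : ℝ, Summable fun n : ℕ => R ^ n * ‖q‖ ^ n.choose 2 * C := fun R =>
    (summable_pow_mul_pow_choose R (norm_nonneg q) hq).mul_right C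
  have hs : ∀ y : ℂ, Summable fun n : ℕ => y ^ n * q ^ n.choose 2 / qPoch q q n := fun y =>
    .of_norm_bounded (hsumb ‖y‖) (hbound _ y le_rfl)
  let e : ℂ → ℂ := fun y => ∑' n : ℕ, y ^ n * q ^ n.choose 2 / qPoch q q n
  have he : ∀ y, e y = (1 - y * -1) * e (y * q) := by
    intro y
    have h1 : HasSum (fun n : ℕ => y ^ n * q ^ n.choose 2 / qPoch q q n -
        (y * q) ^ n * q ^ n.choose 2 / qPoch q q n) (e y - e (y * q)) :=
      (hs y).hasSum.sub (hs (y * q)).hasSum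
    have h2 := (hasSum_nat_add_iff' 1).2 h1
    have h3 : HasSum (fun n : ℕ => y * ((y * q) ^ n * q ^ n.choose 2 / qPoch q q n))
        (y * e (y * q)) := (hs (y * q)).hasSum.mul_left y
    -- The factor 1 - q^(n+1) from the difference cancels the last factor of (q;q)_{n+1}, which
    -- shifts the index by one.
    have h4 := h2.unique <| by
      convert! h3 using 2 with n
      have hp := qPoch_ne_zero_of_norm_lt hq hq n
      have hp' := qPoch_ne_zero_of_norm_lt hq hq (n + 1)
      rw [qPoch_succ] at hp' ⊢
      have hp2 := right_ne_zero_of_mul hp'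
      rw [choose_succ_two]
      field_simp
      ring
    simp only [Finset.range_one, Finset.sum_singleton, pow_zero, sub_self, sub_zero] at h4
    linear_combination h4
  have hL : Tendsto (fun k : ℕ => e (x * q ^ k)) atTop (𝓝 1) := by
    have h0 : ∑' n : ℕ, (0 : ℂ) ^ n * q ^ n.choose 2 / qPoch q q n = 1 := by
      rw [tsum_eq_single 0 fun n hn => by simp [hn]]
      simp
    rw [← h0]
    refine tendsto_tsum_of_dominated_convergence (hsumb ‖x‖) (fun n => ?_)
      (Eventually.of_forall fun k => hbound _ _ ?_)
    · exact (((tendsto_mul_pow_zero x hq).pow n).mul_const _).div_const _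
    · rw [norm_mul]
      exact mul_le_of_le_one_right (norm_nonneg x) (norm_pow_le_one hq k)
  have := eq_qPochInf_mul_of_functional_eq hq he hL
  rw [mul_one, mul_neg_one] at this
  exact this ▸ (hs x).hasSum

/-- `(-q; q)_∞ (q; q²)_∞ = 1`. -/
theorem qPochInf_neg_self_mul {q : ℂ} (hq : ‖q‖ < 1) :
    qPochInf (-q) q * qPochInf q (q ^ 2) = 1 := by
  have h1 := qPochInf_mul_qPochInf_neg q hq
  have h2 := qPochInf_dissect q hq
  rw [← sq] at h2
  have h3 := qPochInf_ne_zero_of_norm_lt (norm_pow_lt_one hq two_ne_zero)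
    (norm_pow_lt_one hq two_ne_zero)
  refine mul_left_cancel₀ h3 ?_
  rw [mul_one]
  linear_combination h1 - qPochInf (-q) q * h2

/-! ### The `q`-analogue of Gauss's second theorem -/

/-- The terms of the `q`-analogue of Gauss's second summation theorem, cleared of the
parameter-dependent denominators. -/
noncomputable def gaussTerm (q a b : ℂ) (n : ℕ) : ℂ :=
  qPoch a q n * qPoch b q n * q ^ (n + 1).choose 2 * qPochInf (a * b * q ^ (2 * n + 1)) (q ^ 2) /
    qPoch q q n

theorem gaussTerm_comm (q a b : ℂ) (n : ℕ) : gaussTerm q a b n = gaussTerm q b a n := by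
  simp only [gaussTerm, mul_comm a b, mul_comm (qPoch a q n)]

/-- The majorant is uniform on a polydisc, as dominated convergence along a q^(2k) → 0 requires. -/
theorem exists_norm_gaussTerm_le {q : ℂ} (hq : ‖q‖ < 1) (A B : ℝ) :
    ∃ u : ℕ → ℝ, Summable u ∧ ∀ a b : ℂ, ‖a‖ ≤ A → ‖b‖ ≤ B → ∀ n, ‖gaussTerm q a b n‖ ≤ u n := by
  obtain ⟨C, hC, hCb⟩ := exists_norm_inv_qPoch_le hq hq
  have hq2 := norm_pow_lt_one hq two_ne_zero
  refine ⟨fun n => Real.exp (A / (1 - ‖q‖)) * Real.exp (B / (1 - ‖q‖)) *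
    (‖q‖ ^ n * ‖q‖ ^ n.choose 2) * Real.exp (A * B / (1 - ‖q ^ 2‖)) * C,
    (((summable_pow_mul_pow_choose ‖q‖ (norm_nonneg q) hq).mul_left _).mul_right _).mul_right _,
    fun a b ha hb n => ?_⟩
  have hA := (norm_nonneg a).trans ha
  rw [gaussTerm, div_eq_mul_inv, norm_mul, norm_mul, norm_mul, norm_mul, choose_succ_two, pow_add,
    norm_mul, norm_pow, norm_pow]
  have h1 : ‖a * b * q ^ (2 * n + 1)‖ ≤ A * B := by
    rw [norm_mul, norm_mul]
    exact (mul_le_of_le_one_right (by positivity) (norm_pow_le_one hq _)).trans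
      (mul_le_mul ha hb (norm_nonneg b) hA)
  beta_reduce
  gcongr
  · exact norm_qPoch_le hq ha n
  · exact norm_qPoch_le hq hb n
  · exact norm_qPochInf_le hq2 h1
  · exact hCb n

theorem summable_gaussTerm {q : ℂ} (hq : ‖q‖ < 1) (a b : ℂ) : Summable (gaussTerm q a b) := by
  obtain ⟨u, hu, h⟩ := exists_norm_gaussTerm_le hq ‖a‖ ‖b‖
  exact .of_norm_bounded hu (h a b le_rfl le_rfl)

/-- The remainder on the right tends to 0, so in the limit this is the functional equation a → aq²
of the full sum. -/
theorem sum_gaussTerm_sub {q : ℂ} (hq : ‖q‖ < 1) (a b : ℂ) (n : ℕ) :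
    ∑ i ∈ Finset.range (n + 1),
        (gaussTerm q a b i - (1 - a * q) * gaussTerm q (a * q ^ 2) b i) =
      a * (1 - b) * q ^ (n + 1) * gaussTerm q (a * q) (b * q) n := by
  have hq2 := norm_pow_lt_one hq two_ne_zero
  induction n with
  | zero =>
    simp only [gaussTerm, zero_add, Finset.range_one, Finset.sum_singleton, qPoch_zero_right,
      mul_zero, pow_one, Nat.choose_succ_self, pow_zero, mul_one, div_one, one_mul]
    rw [qPochInf_eq_mul (a * b * q) hq2]
    ring_nf
  | succ n ih =>
    rw [Finset.sum_range_succ, ih]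
    have hp := qPoch_ne_zero_of_norm_lt hq hq n
    have hp' := qPoch_ne_zero_of_norm_lt hq hq (n + 1)
    have e1 : qPoch a q (n + 1) = (1 - a) * qPoch (a * q) q n := qPoch_succ_left a q n
    have e2 : qPoch b q (n + 1) = (1 - b) * qPoch (b * q) q n := qPoch_succ_left b q n
    have e3 : (1 - a * q) * qPoch (a * q ^ 2) q (n + 1) =
        qPoch (a * q) q n * (1 - a * q * q ^ n) * (1 - a * q * q ^ (n + 1)) := by
      rw [← qPoch_succ, ← qPoch_succ, qPoch_succ_left (a * q) q (n + 1)]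
      ring_nf
    have e4 : qPochInf (a * q * b * q * q ^ (2 * n + 1)) (q ^ 2) =
        (1 - a * b * q ^ (2 * n + 3)) * qPochInf (a * b * q ^ (2 * n + 5)) (q ^ 2) := by
      rw [qPochInf_eq_mul _ hq2]
      ring_nf
    have e5 : qPochInf (a * b * q ^ (2 * (n + 1) + 1)) (q ^ 2) =
        (1 - a * b * q ^ (2 * n + 3)) * qPochInf (a * b * q ^ (2 * n + 5)) (q ^ 2) := by
      rw [qPochInf_eq_mul _ hq2]
      ring_nf
    have e6 : a * q ^ 2 * b * q ^ (2 * (n + 1) + 1) = a * b * q ^ (2 * n + 5) := by ring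
    have e7 : a * q * b * q * q ^ (2 * (n + 1) + 1) = a * b * q ^ (2 * n + 5) := by ring
    have e8 : (n + 1 + 1).choose 2 = n + 1 + (n + 1).choose 2 := choose_succ_two _
    simp only [gaussTerm, ← mul_div_assoc, ← mul_assoc]
    rw [e3, e4, e5, e6, e7, e8, e1, e2, qPoch_succ (a * q), qPoch_succ (b * q), qPoch_succ q]
    rw [qPoch_succ] at hp'
    have hp2 := right_ne_zero_of_mul hp'
    field_simp
    ring

theorem tsum_gaussTerm_eq {q : ℂ} (hq : ‖q‖ < 1) (a b : ℂ) :
    ∑' n, gaussTerm q a b n = (1 - a * q) * ∑' n, gaussTerm q (a * q ^ 2) b n := by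
  rw [← sub_eq_zero]
  have h := ((summable_gaussTerm hq a b).hasSum.sub
    ((summable_gaussTerm hq (a * q ^ 2) b).hasSum.mul_left (1 - a * q))).tendsto_sum_nat
  refine tendsto_nhds_unique ((tendsto_add_atTop_iff_nat 1).2 h) ?_
  simp only [sum_gaussTerm_sub hq]
  have h1 := ((tendsto_mul_pow_zero 1 hq).comp (tendsto_add_atTop_nat 1)).const_mul (a * (1 - b))
  simpa using h1.mul (summable_gaussTerm hq (a * q) (b * q)).tendsto_atTop_zero

theorem tsum_gaussTerm_eq_mul {q : ℂ} (hq : ‖q‖ < 1) (a b : ℂ) :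
    ∑' n, gaussTerm q a b n = qPochInf (a * q) (q ^ 2) * ∑' n, gaussTerm q 0 b n := by
  have hq2 := norm_pow_lt_one hq two_ne_zero
  refine eq_qPochInf_mul_of_functional_eq (e := fun y => ∑' n, gaussTerm q y b n) hq2
    (fun y => tsum_gaussTerm_eq hq y b) ?_
  obtain ⟨u, hu, h⟩ := exists_norm_gaussTerm_le hq ‖a‖ ‖b‖
  refine tendsto_tsum_of_dominated_convergence hu (fun n => ?_)
    (Eventually.of_forall fun k => h _ _ ?_ le_rfl)
  · have h0 := tendsto_mul_pow_zero a hq2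
    have h1 : Tendsto (fun k : ℕ => a * (q ^ 2) ^ k * b * q ^ (2 * n + 1)) atTop (𝓝 0) := by
      simpa using (h0.mul_const b).mul_const (q ^ (2 * n + 1))
    have := ((((tendsto_qPoch_one q n h0).mul_const (qPoch b q n)).mul_const
      (q ^ (n + 1).choose 2)).mul (tendsto_qPochInf_one hq2 h1)).div_const (qPoch q q n)
    simpa [gaussTerm] using this
  · rw [norm_mul]
    exact mul_le_of_le_one_right (norm_nonneg a) (norm_pow_le_one hq2 k)

theorem hasSum_gaussTerm {q : ℂ} (hq : ‖q‖ < 1) (a b : ℂ) :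
    HasSum (gaussTerm q a b)
      (qPochInf (a * q) (q ^ 2) * qPochInf (b * q) (q ^ 2) * qPochInf (-q) q) := by
  have h0 : ∑' n, gaussTerm q 0 0 n = qPochInf (-q) q := by
    rw [← (hasSum_euler q hq).tsum_eq]
    refine tsum_congr fun n => ?_
    simp [gaussTerm, choose_succ_two, pow_add]
  have h := tsum_gaussTerm_eq_mul hq a b
  rw [tsum_congr (gaussTerm_comm q 0 b), tsum_gaussTerm_eq_mul hq b 0, h0, ← mul_assoc] at h
  exact h ▸ (summable_gaussTerm hq a b).hasSum

/-- When the parameters have product q³, the infinite product inside `gaussTerm` is the tail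
(q^(2n+4);q²)_∞, that is (q²;q²)_∞/(q²;q²)_{n+1}. -/
theorem hasSum_gauss_second {q : ℂ} (hq : ‖q‖ < 1) {b : ℂ} (hb : b ≠ 0) :
    HasSum
      (fun n : ℕ => qPoch b q n * qPoch (q ^ 3 / b) q n * q ^ (n * (n + 1) / 2) /
        (qPoch (q ^ 2) (q ^ 2) (n + 1) * qPoch q q n))
      (qPochInf (q ^ 4 / b) (q ^ 2) * qPochInf (b * q) (q ^ 2) / qPochInf q q) := by
  have hq2 := norm_pow_lt_one hq two_ne_zero
  have hP := qPochInf_ne_zero_of_norm_lt hq2 hq2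
  have hQ := qPochInf_ne_zero_of_norm_lt hq hq
  convert! (hasSum_gaussTerm hq b (q ^ 3 / b)).div_const (qPochInf (q ^ 2) (q ^ 2)) using 1
  · ext n
    have hp := qPoch_ne_zero_of_norm_lt hq hq n
    have hp2 := qPoch_ne_zero_of_norm_lt hq2 hq2 (n + 1)
    have e : b * (q ^ 3 / b) * q ^ (2 * n + 1) = q ^ 2 * (q ^ 2) ^ (n + 1) := by
      field_simp
      ring
    have hi : qPochInf (q ^ 2 * (q ^ 2) ^ (n + 1)) (q ^ 2) ≠ 0 :=
      right_ne_zero_of_mul (qPochInf_eq_qPoch_mul (q ^ 2) hq2 (n + 1) ▸ hP)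
    rw [gaussTerm, e, qPochInf_eq_qPoch_mul (q ^ 2) hq2 (n + 1), Nat.choose_two_right,
      Nat.add_sub_cancel, mul_comm (n + 1) n]
    field_simp
  · have h1 := qPochInf_neg_self_mul hq
    have h2 := qPochInf_dissect q hq
    rw [← sq] at h2
    rw [show q ^ 3 / b * q = q ^ 4 / b by ring]
    rw [mul_comm b q]
    field_simp
    rw [h2]
    linear_combination (-qPochInf (q ^ 4 / b) (q ^ 2) * qPochInf (q * b) (q ^ 2) *
      qPochInf (q ^ 2) (q ^ 2)) * h1

theorem hasSum_neg_qPoch {q : ℂ} (hq : ‖q‖ < 1) :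
    HasSum
      (fun n : ℕ+ => qPoch (-q) q n * q ^ (((n : ℕ) ^ 2 - (n : ℕ)) / 2) /
        qPoch q q ((n : ℕ) - 1))
      (qPochInf (-q) q * qPochInf (-q) (q ^ 2)) := by
  rw [hasSum_pnat_iff_hasSum_succ (f := fun n : ℕ => qPoch (-q) q n * q ^ ((n ^ 2 - n) / 2) /
        qPoch q q (n - 1))]
  have hq2 := norm_pow_lt_one hq two_ne_zero
  -- The factor 1 + q completes (-q²;q)_n to (-q;q)_{n+1} in the terms, and (-q³;q²)_∞ to (-q;q²)_∞
  -- in the value.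
  convert! (hasSum_gaussTerm hq (-q ^ 2) 0).mul_left (1 + q) using 1
  · ext n
    rw [qPoch_succ_left, gaussTerm, Nat.choose_two_right]
    simp only [Nat.add_sub_cancel, sub_neg_eq_add, qPoch_zero_left, mul_zero, zero_mul,
      qPochInf_zero_left, mul_one]
    rw [show (n + 1) ^ 2 - (n + 1) = (n + 1) * n by
      rw [sq, ← Nat.mul_sub_one, Nat.add_sub_cancel]]
    ring_nf
  · rw [qPochInf_eq_mul (-q) hq2]
    simp only [zero_mul, qPochInf_zero_left]
    ring_nf

/-! ### The Jacobi triple product -/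

/-- The number `n (n - 1) / 2`, for an integer `n`. -/
def triNat (n : ℤ) : ℕ := (n * (n - 1) / 2).toNat

/-- Removes the division and the truncation, so that exponent identities become linear arithmetic.
Natural exponents let `thetaTerm` make sense when a base is 0. -/
theorem two_mul_triNat (n : ℤ) : 2 * (triNat n : ℤ) = n * (n - 1) := by
  have h1 : 2 * (n * (n - 1) / 2) = n * (n - 1) :=
    Int.mul_ediv_cancel' (by simpa [mul_comm] using (Int.even_mul_succ_self (n - 1)).two_dvd)
  have h2 : 0 ≤ n * (n - 1) := by
    rcases le_or_gt n 0 with h | h <;> nlinarith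
  rw [triNat, Int.toNat_of_nonneg (by omega), h1]

theorem triNat_eq_iff {n : ℤ} {m : ℕ} : triNat n = m ↔ 2 * (m : ℤ) = n * (n - 1) := by
  rw [← two_mul_triNat]; omega

theorem triNat_natCast (n : ℕ) : triNat n = n.choose 2 := by
  rw [triNat_eq_iff]
  have : 2 * (n.choose 2 : ℤ) + n = n ^ 2 := by exact_mod_cast two_mul_choose_two n
  linarith

theorem triNat_add_one (n : ℤ) : (triNat (n + 1) : ℤ) = triNat n + n := by
  have h1 := two_mul_triNat n
  have h2 := two_mul_triNat (n + 1)
  linarith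

theorem triNat_neg (n : ℤ) : triNat (-n) = triNat (n + 1) := by
  rw [triNat_eq_iff, two_mul_triNat]; ring

/-- The terms `a^(n(n+1)/2) b^(n(n-1)/2)` of Ramanujan's theta function. -/
noncomputable def thetaTerm (a b : ℂ) (n : ℤ) : ℂ := a ^ triNat (n + 1) * b ^ triNat n

theorem thetaTerm_natCast (a b : ℂ) (n : ℕ) :
    thetaTerm a b n = a ^ n * (a * b) ^ n.choose 2 := by
  rw [thetaTerm, ← Nat.cast_succ, triNat_natCast, triNat_natCast, choose_succ_two]
  ring

theorem thetaTerm_neg (a b : ℂ) (n : ℤ) : thetaTerm a b (-n) = thetaTerm b a n := by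
  have : triNat (-n + 1) = triNat n := by rw [← triNat_neg]; simp
  rw [thetaTerm, thetaTerm, this, triNat_neg, mul_comm]

theorem summable_norm_thetaTerm {a b : ℂ} (hq : ‖a * b‖ < 1) :
    Summable fun n : ℤ => ‖thetaTerm a b n‖ := by
  have h : ∀ a b : ℂ, ‖a * b‖ < 1 → Summable fun n : ℕ => ‖thetaTerm a b n‖ := by
    intro a b hq
    simpa [thetaTerm_natCast] using
      summable_pow_mul_pow_choose ‖a‖ (norm_nonneg (a * b)) hq
  refine .of_nat_of_neg (h a b hq) ?_
  simpa only [thetaTerm_neg] using h b a (by rwa [mul_comm])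

theorem thetaTerm_shift (a b : ℂ) (k m : ℕ) :
    thetaTerm a b (m - (k + 1 : ℕ)) * (a * b) ^ m = b * (a * b) ^ k * thetaTerm a b (m - k) := by
  have h1 : triNat ((m : ℤ) - (k + 1 : ℕ) + 1) + m = k + triNat ((m : ℤ) - k + 1) := by
    have h := triNat_add_one ((m : ℤ) - k)
    rw [show (m : ℤ) - (k + 1 : ℕ) + 1 = (m : ℤ) - k by push_cast; ring]
    omega
  have h2 : triNat ((m : ℤ) - (k + 1 : ℕ)) + m = 1 + k + triNat ((m : ℤ) - k) := by
    have h := triNat_add_one ((m : ℤ) - (k + 1 : ℕ))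
    rw [show (m : ℤ) - (k + 1 : ℕ) + 1 = (m : ℤ) - k by push_cast; ring] at h
    push_cast at h ⊢
    omega
  calc _ = a ^ (triNat ((m : ℤ) - (k + 1 : ℕ) + 1) + m) *
        b ^ (triNat ((m : ℤ) - (k + 1 : ℕ)) + m) := by rw [thetaTerm]; ring
    _ = _ := by rw [h1, h2, thetaTerm]; ring

/-- The bilateral sum with the factors `1 / (ab; ab)_{n+k}` inserted. -/
theorem hasSum_thetaTerm_div_qPoch {a b : ℂ} (hq : ‖a * b‖ < 1) (k : ℕ) :
    HasSum (fun m : ℕ => thetaTerm a b (m - k) / qPoch (a * b) (a * b) m)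
      (qPoch (-b) (a * b) k * qPochInf (-a) (a * b)) := by
  obtain ⟨C, hC, hCb⟩ := exists_norm_inv_qPoch_le hq hq
  have hs : ∀ k : ℕ, Summable fun m : ℕ => thetaTerm a b (m - k) / qPoch (a * b) (a * b) m := by
    intro k
    have hinj : Function.Injective fun m : ℕ => (m : ℤ) - k := fun x y h => by simpa using h
    refine .of_norm_bounded (((summable_norm_thetaTerm hq).comp_injective hinj).mul_right C)
      fun m => ?_
    rw [div_eq_mul_inv, norm_mul]
    exact mul_le_mul_of_nonneg_left (hCb m) (norm_nonneg _)
  induction k with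
  | zero =>
    simpa [thetaTerm_natCast] using hasSum_euler a hq
  | succ k ih =>
    -- Split 1 = (1 - (ab)^m) + (ab)^m. The first part kills m = 0 and shifts to the case k; by
    -- `thetaTerm_shift` the second is b(ab)^k times the case k.
    have h1 : HasSum (fun m : ℕ => thetaTerm a b (m - (k + 1 : ℕ)) / qPoch (a * b) (a * b) m *
        (1 - (a * b) ^ m)) (qPoch (-b) (a * b) k * qPochInf (-a) (a * b)) := by
      rw [← hasSum_nat_add_iff' 1]
      simp only [Finset.range_one, Finset.sum_singleton, pow_zero, sub_self, mul_zero, sub_zero]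
      convert! ih using 2 with m
      have hp := qPoch_ne_zero_of_norm_lt hq hq (m + 1)
      rw [qPoch_succ] at hp ⊢
      have hp1 := left_ne_zero_of_mul hp
      have hp2 := right_ne_zero_of_mul hp
      rw [show ((m + 1 : ℕ) : ℤ) - (k + 1 : ℕ) = m - k by push_cast; ring, pow_succ']
      field_simp
    have h2 := h1.add (ih.mul_left (b * (a * b) ^ k))
    convert! h2 using 1
    · ext m
      rw [← mul_div_assoc, ← thetaTerm_shift]
      ring
    · rw [qPoch_succ]; ring

/-- Put n = m - k in `hasSum_thetaTerm_div_qPoch` and let k → ∞: each 1/(ab;ab)_{n+k} tends to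
1/(ab;ab)_∞, under a summable majorant. -/
theorem hasSum_thetaTerm {a b : ℂ} (hq : ‖a * b‖ < 1) :
    HasSum (thetaTerm a b)
      (qPochInf (-a) (a * b) * qPochInf (-b) (a * b) * qPochInf (a * b) (a * b)) := by
  obtain ⟨C, hC, hCb⟩ := exists_norm_inv_qPoch_le hq hq
  have hP := qPochInf_ne_zero_of_norm_lt hq hq
  -- Extension by zero below -k puts the sums for all k over the same index set ℤ.
  set f : ℕ → ℤ → ℂ := fun k n =>
    if -(k : ℤ) ≤ n then thetaTerm a b n / qPoch (a * b) (a * b) (n + k).toNat else 0 with hf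
  have hfk : ∀ k, ∑' n, f k n = qPoch (-b) (a * b) k * qPochInf (-a) (a * b) := by
    intro k
    have hinj : Function.Injective fun m : ℕ => (m : ℤ) - k := fun x y h => by simpa using h
    rw [← (hasSum_thetaTerm_div_qPoch hq k).tsum_eq, ← hinj.tsum_eq]
    · refine tsum_congr fun m => ?_
      simp [hf]
    · intro n hn
      have : -(k : ℤ) ≤ n := by
        by_contra h
        simp [hf, h] at hn
      exact ⟨(n + k).toNat, by simp only; omega⟩
  have hlim : Tendsto (fun k => ∑' n, f k n) atTop
      (𝓝 (∑' n, thetaTerm a b n / qPochInf (a * b) (a * b))) := by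
    refine tendsto_tsum_of_dominated_convergence ((summable_norm_thetaTerm hq).mul_right C)
      (fun n => ?_) (Eventually.of_forall fun k n => ?_)
    · have h1 : Tendsto (fun k : ℕ => (n + k).toNat) atTop atTop := by
        refine tendsto_atTop_mono (f := fun k : ℕ => k - n.natAbs) (fun k => by omega)
          (tendsto_sub_atTop_nat _)
      refine Tendsto.congr' ?_
        (tendsto_const_nhds.div ((qPoch_tendsto_qPochInf (a * b) hq).comp h1) hP)
      filter_upwards [eventually_ge_atTop n.natAbs] with k hk
      simp only [hf, Pi.div_apply, Function.comp_apply]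
      rw [if_pos (by omega)]
    · simp only [hf]
      split_ifs
      · rw [div_eq_mul_inv, norm_mul]
        exact mul_le_mul_of_nonneg_left (hCb _) (norm_nonneg _)
      · simp only [norm_zero]; positivity
  simp only [hfk] at hlim
  have h := tendsto_nhds_unique hlim ((qPoch_tendsto_qPochInf (-b) hq).mul_const _)
  rw [tsum_div_const, div_eq_iff hP] at h
  have := (summable_norm_thetaTerm hq).of_norm.hasSum
  rw [h] at this
  convert! this using 1
  ring

/-! ### Parity splitting of the theta series -/

theorem isCompl_range_two_mul :
    IsCompl (Set.range fun n : ℤ => 2 * n) (Set.range fun n : ℤ => 1 - 2 * n) := by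
  refine IsCompl.of_eq ?_ ?_
  · ext x
    simp only [Set.bot_eq_empty, Set.inf_eq_inter, Set.mem_inter_iff, Set.mem_range,
      Set.mem_empty_iff_false, iff_false]
    rintro ⟨⟨y, rfl⟩, z, hz⟩
    omega
  · ext x
    simp only [Set.sup_eq_union, Set.mem_union, Set.mem_range, Set.top_eq_univ, Set.mem_univ,
      iff_true]
    rcases Int.even_or_odd' x with ⟨k, rfl | rfl⟩
    · exact .inl ⟨k, rfl⟩
    · exact .inr ⟨-k, by ring⟩

theorem thetaTerm_two_mul (q : ℂ) (n : ℤ) :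
    thetaTerm q (q ^ 3) (2 * n) = thetaTerm (q ^ 6) (q ^ 10) n := by
  have h1 := two_mul_triNat (2 * n)
  have h2 := two_mul_triNat (2 * n + 1)
  have h3 := two_mul_triNat n
  have h4 := two_mul_triNat (n + 1)
  have h5 : 6 * triNat (n + 1) + 10 * triNat n = triNat (2 * n + 1) + 3 * triNat (2 * n) := by
    zify
    linarith
  rw [thetaTerm, thetaTerm, ← pow_mul, ← pow_mul, ← pow_mul, ← pow_add, ← pow_add, h5]

/-- Indexing the odd integers by 1 - 2n, rather than 2n + 1, yields the bases in the order q², q¹⁴.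
-/
theorem thetaTerm_one_sub_two_mul (q : ℂ) (n : ℤ) :
    thetaTerm q (q ^ 3) (1 - 2 * n) = q * thetaTerm (q ^ 2) (q ^ 14) n := by
  have h1 := two_mul_triNat (1 - 2 * n)
  have h2 := two_mul_triNat (1 - 2 * n + 1)
  have h3 := two_mul_triNat n
  have h4 := two_mul_triNat (n + 1)
  have h5 : 2 * triNat (n + 1) + 14 * triNat n + 1 =
      triNat (1 - 2 * n + 1) + 3 * triNat (1 - 2 * n) := by
    zify
    linarith
  rw [thetaTerm, thetaTerm, ← pow_mul, ← pow_mul, ← pow_mul, ← pow_add, ← pow_add,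
    ← pow_succ', h5]

theorem hasSum_of_hasSum_even_odd {f : ℤ → ℂ} {x y : ℂ} (h0 : HasSum (fun n => f (2 * n)) x)
    (h1 : HasSum (fun n => f (1 - 2 * n)) y) : HasSum f (x + y) := by
  have hinj0 : Function.Injective fun n : ℤ => 2 * n := fun x y h => by simp only at h; omega
  have hinj1 : Function.Injective fun n : ℤ => 1 - 2 * n := fun x y h => by simp only at h; omega
  exact (hinj0.hasSum_range_iff.2 h0).add_isCompl isCompl_range_two_mul
    (hinj1.hasSum_range_iff.2 h1)

/-- The series `∑ q^(2n²+n)` split into its terms of even and odd index. -/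
theorem theta_add_mul_theta {q : ℂ} (hq : ‖q‖ < 1) :
    qPochInf (-q ^ 6) (q ^ 16) * qPochInf (-q ^ 10) (q ^ 16) * qPochInf (q ^ 16) (q ^ 16) +
      q * (qPochInf (-q ^ 2) (q ^ 16) * qPochInf (-q ^ 14) (q ^ 16) *
        qPochInf (q ^ 16) (q ^ 16)) =
    qPochInf (-q) (q ^ 2) * qPochInf (q ^ 4) (q ^ 4) := by
  have e6 : q ^ 6 * q ^ 10 = q ^ 16 := by ring
  have e2 : q ^ 2 * q ^ 14 = q ^ 16 := by ring
  have e1 : q * q ^ 3 = q ^ 4 := by ring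
  have hq4 := norm_pow_lt_one hq (n := 4) (by norm_num)
  have hq16 := norm_pow_lt_one hq (n := 16) (by norm_num)
  have hA := hasSum_thetaTerm (e6 ▸ hq16)
  have hB := (hasSum_thetaTerm (e2 ▸ hq16)).mul_left q
  have hT := hasSum_thetaTerm (e1 ▸ hq4)
  rw [e6] at hA
  rw [e2] at hB
  rw [e1] at hT
  simp only [← thetaTerm_one_sub_two_mul] at hB
  rw [← (funext (thetaTerm_two_mul q) : _ = thetaTerm (q ^ 6) (q ^ 10))] at hA
  rw [(hasSum_of_hasSum_even_odd hA hB).unique hT,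
    qPochInf_dissect (-q) (norm_pow_lt_one hq two_ne_zero)]
  ring_nf

theorem two_mul_qPochInf_neg {q : ℂ} (hq : ‖q‖ < 1) : qPochInf (-1) q = 2 * qPochInf (-q) q := by
  rw [qPochInf_eq_mul (-1) hq]
  norm_num

/-- The sum and the difference of the two theta quotients. -/
theorem theta_quotient_add {q : ℂ} (hq : ‖q‖ < 1) :
    qPochInf (-1) q * (qPochInf (-q ^ 6) (q ^ 16) * qPochInf (-q ^ 10) (q ^ 16) *
        qPochInf (q ^ 16) (q ^ 16)) / qPochInf (q ^ 4) (q ^ 4) +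
      q * (qPochInf (-1) q * (qPochInf (-q ^ 2) (q ^ 16) * qPochInf (-q ^ 14) (q ^ 16) *
        qPochInf (q ^ 16) (q ^ 16)) / qPochInf (q ^ 4) (q ^ 4)) =
    2 * (qPochInf (-q) q * qPochInf (-q) (q ^ 2)) := by
  have hq4 := norm_pow_lt_one hq (n := 4) (by norm_num)
  have h := theta_add_mul_theta hq
  have h4 := qPochInf_ne_zero_of_norm_lt hq4 hq4
  rw [two_mul_qPochInf_neg hq]
  field_simp
  linear_combination qPochInf (-q) q * h

/-- Under q → -q only the explicit factor q and (-q;q²)_∞ change in `theta_add_mul_theta`; the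
resulting (q;q²)_∞ cancels (-q;q)_∞. -/
theorem theta_quotient_sub {q : ℂ} (hq : ‖q‖ < 1) :
    qPochInf (-1) q * (qPochInf (-q ^ 6) (q ^ 16) * qPochInf (-q ^ 10) (q ^ 16) *
        qPochInf (q ^ 16) (q ^ 16)) / qPochInf (q ^ 4) (q ^ 4) -
      q * (qPochInf (-1) q * (qPochInf (-q ^ 2) (q ^ 16) * qPochInf (-q ^ 14) (q ^ 16) *
        qPochInf (q ^ 16) (q ^ 16)) / qPochInf (q ^ 4) (q ^ 4)) = 2 := by
  have hq4 := norm_pow_lt_one hq (n := 4) (by norm_num)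
  have h := theta_add_mul_theta (q := -q) (by rwa [norm_neg])
  rw [neg_neg, Even.neg_pow (by decide : Even 6), Even.neg_pow (by decide : Even 10),
    Even.neg_pow (by decide : Even 16), Even.neg_pow (by decide : Even 2),
    Even.neg_pow (by decide : Even 14), Even.neg_pow (by decide : Even 4)] at h
  have h4 := qPochInf_ne_zero_of_norm_lt hq4 hq4
  have h1 := qPochInf_neg_self_mul hq
  rw [two_mul_qPochInf_neg hq]
  field_simp
  linear_combination qPochInf (-q) q * h + qPochInf (q ^ 4) (q ^ 4) * h1

/-! ### The Göllnitz–Gordon identities -/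

/-- The terms `(A; q²)_n zⁿ q^(n²) / (q²; q²)_n`. -/
noncomputable def gordonTerm (q A z : ℂ) (n : ℕ) : ℂ :=
  qPoch A (q ^ 2) n * z ^ n * q ^ n ^ 2 / qPoch (q ^ 2) (q ^ 2) n

theorem exists_norm_gordonTerm_le {q : ℂ} (hq : ‖q‖ < 1) (A : ℂ) (R : ℝ) :
    ∃ u : ℕ → ℝ, Summable u ∧ ∀ z : ℂ, ‖z‖ ≤ R → ∀ n, ‖gordonTerm q A z n‖ ≤ u n := by
  have hq2 := norm_pow_lt_one hq two_ne_zero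
  obtain ⟨C, hC, hCb⟩ := exists_norm_inv_qPoch_le hq2 hq2
  refine ⟨fun n => Real.exp (‖A‖ / (1 - ‖q ^ 2‖)) * ((R * ‖q‖) ^ n * ‖q ^ 2‖ ^ n.choose 2) * C,
    ((summable_pow_mul_pow_choose _ (norm_nonneg _) hq2).mul_left _).mul_right _,
    fun z hz n => ?_⟩
  have hR := (norm_nonneg z).trans hz
  have e : q ^ n ^ 2 = q ^ n * (q ^ 2) ^ n.choose 2 := by
    rw [← two_mul_choose_two n, pow_add, pow_mul, mul_comm]
  rw [gordonTerm, e, div_eq_mul_inv, norm_mul, mul_assoc (qPoch _ _ _), norm_mul, ← mul_assoc,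
    ← mul_pow, norm_mul, norm_pow, norm_pow _ (n.choose 2), norm_mul]
  beta_reduce
  gcongr
  · exact norm_qPoch_le hq2 le_rfl n
  · exact hCb n

theorem summable_gordonTerm {q : ℂ} (hq : ‖q‖ < 1) (A z : ℂ) : Summable (gordonTerm q A z) := by
  obtain ⟨u, hu, h⟩ := exists_norm_gordonTerm_le hq A ‖z‖
  exact .of_norm_bounded hu (h z le_rfl)

theorem gordonTerm_zero (q A z : ℂ) : gordonTerm q A z 0 = 1 := by simp [gordonTerm]

/-- Term n + 1 of the difference of the sums at z and zq² matches term n of the rest, since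
q^(2n+1)(1 + q^(2n+1)) = q·q^(2n) + q²·q^(4n). -/
theorem tsum_gordonTerm_eq {q : ℂ} (hq : ‖q‖ < 1) (z : ℂ) :
    ∑' n, gordonTerm q (-q) z n = (1 + z * q) * ∑' n, gordonTerm q (-q) (z * q ^ 2) n +
      z * q ^ 2 * ∑' n, gordonTerm q (-q) (z * q ^ 2 * q ^ 2) n := by
  have hq2 := norm_pow_lt_one hq two_ne_zero
  have s0 := (summable_gordonTerm hq (-q) z).hasSum
  have s1 := (summable_gordonTerm hq (-q) (z * q ^ 2)).hasSum
  have s2 := (summable_gordonTerm hq (-q) (z * q ^ 2 * q ^ 2)).hasSum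
  have h1 := (hasSum_nat_add_iff' 1).2 (s0.sub s1)
  have h2 := (s1.mul_left (z * q)).add (s2.mul_left (z * q ^ 2))
  have h := h1.unique <| by
    convert! h2 using 2 with n
    have hp := qPoch_ne_zero_of_norm_lt hq2 hq2 (n + 1)
    rw [gordonTerm, gordonTerm, gordonTerm, gordonTerm]
    rw [qPoch_succ] at hp ⊢
    rw [qPoch_succ]
    have hp1 := left_ne_zero_of_mul hp
    have hp2 := right_ne_zero_of_mul hp
    field_simp
    ring
  simp only [Finset.range_one, Finset.sum_singleton, gordonTerm_zero] at h
  linear_combination h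

/-- The coefficients of zⁿ agree, because (1 + q^(2n+1)) - (1 - q^(2n)) = q^(2n)(1 + q) and 1 + q
turns (-q³;q²)_{n-1} into (-q;q²)_n. -/
theorem tsum_gordonTerm_sub {q : ℂ} (hq : ‖q‖ < 1) (z : ℂ) :
    HasSum (fun n => gordonTerm q (-q ^ 3) z n - z * q * gordonTerm q (-q ^ 3) (z * q ^ 2) n)
      (∑' n, gordonTerm q (-q) (z * q ^ 2) n) := by
  have hq2 := norm_pow_lt_one hq two_ne_zero
  have s0 := (summable_gordonTerm hq (-q ^ 3) z).hasSum
  have s1 := (summable_gordonTerm hq (-q ^ 3) (z * q ^ 2)).hasSum.mul_left (z * q)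
  have s2 := (summable_gordonTerm hq (-q) (z * q ^ 2)).hasSum
  have h := (((hasSum_nat_add_iff' 1).2 s0).sub s1).unique <| by
    convert! (hasSum_nat_add_iff' 1).2 s2 using 2 with n
    have hp := qPoch_ne_zero_of_norm_lt hq2 hq2 (n + 1)
    have e : qPoch (-q) (q ^ 2) (n + 1) = (1 + q) * qPoch (-q ^ 3) (q ^ 2) n := by
      rw [qPoch_succ_left]; ring_nf
    rw [gordonTerm, gordonTerm, gordonTerm, e]
    rw [qPoch_succ] at hp ⊢
    rw [qPoch_succ]
    have hp1 := left_ne_zero_of_mul hp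
    have hp2 := right_ne_zero_of_mul hp
    field_simp
    ring
  simp only [Finset.range_one, Finset.sum_singleton, gordonTerm_zero] at h
  convert! s0.sub s1 using 1
  linear_combination -h

theorem tendsto_tsum_gordonTerm {q : ℂ} (hq : ‖q‖ < 1) (A : ℂ) :
    Tendsto (fun k : ℕ => ∑' n, gordonTerm q A ((q ^ 2) ^ k) n) atTop (𝓝 1) := by
  have hq2 := norm_pow_lt_one hq two_ne_zero
  have h0 : ∑' n, gordonTerm q A 0 n = 1 := by
    rw [tsum_eq_single 0 fun n hn => by simp [gordonTerm, hn], gordonTerm_zero]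
  rw [← h0]
  obtain ⟨u, hu, h⟩ := exists_norm_gordonTerm_le hq A 1
  refine tendsto_tsum_of_dominated_convergence hu (fun n => ?_)
    (Eventually.of_forall fun k => h _ (norm_pow_le_one hq2 k))
  exact ((((tendsto_pow_atTop_nhds_zero_of_norm_lt_one hq2).pow n).const_mul _).mul_const
    _).div_const _

/-- A solution of the Göllnitz–Gordon recurrence which tends to zero vanishes. -/
theorem eq_zero_of_gordon_recurrence {q : ℂ} (hq : ‖q‖ < 1) {D : ℕ → ℂ}
    (hD : ∀ k, D k = (1 + (q ^ 2) ^ k * q) * D (k + 1) + (q ^ 2) ^ k * q ^ 2 * D (k + 2))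
    (hlim : Tendsto D atTop (𝓝 0)) (k : ℕ) : D k = 0 := by
  have hq2 := norm_pow_lt_one hq two_ne_zero
  set r := ‖q ^ 2‖ with hr
  have hr0 : 0 ≤ r := norm_nonneg _
  set M : ℕ → ℝ := fun k => max ‖D k‖ ‖D (k + 1)‖ with hM
  -- S k is the tail sum of 2rʲ over j ≥ k. The weight exp(-S k) absorbs the growth factors
  -- exp(2rʲ), so M k · exp(-S k) increases to 0 and is therefore at most 0.
  set S : ℕ → ℝ := fun k => 2 * r ^ k / (1 - r) with hS
  have hM0 (k) : 0 ≤ M k := (norm_nonneg _).trans (le_max_left _ _)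
  have hMs (k) : M k ≤ Real.exp (2 * r ^ k) * M (k + 1) := by
    have h1 : 1 + 2 * r ^ k ≤ Real.exp (2 * r ^ k) := by
      rw [add_comm]; exact Real.add_one_le_exp _
    have h2 : 0 ≤ r ^ k := pow_nonneg hr0 k
    refine le_trans (max_le ?_ ?_) (mul_le_mul_of_nonneg_right h1 (hM0 _))
    · rw [hD k]
      refine (norm_add_le _ _).trans ?_
      have h3 : ‖1 + (q ^ 2) ^ k * q‖ ≤ 1 + r ^ k := by
        refine (norm_add_le _ _).trans ?_
        rw [norm_one, norm_mul, norm_pow _ k]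
        gcongr
        exact mul_le_of_le_one_right h2 hq.le
      have h4 : ‖(q ^ 2) ^ k * q ^ 2‖ ≤ r ^ k := by
        rw [norm_mul, norm_pow _ k]
        exact mul_le_of_le_one_right h2 hq2.le
      rw [norm_mul, norm_mul]
      calc _ ≤ (1 + r ^ k) * M (k + 1) + r ^ k * M (k + 1) := by
            gcongr
            · exact le_max_left _ _
            · exact le_max_right _ _
        _ = _ := by ring
    · calc _ ≤ M (k + 1) := le_max_left _ _
        _ ≤ _ := by nlinarith [hM0 (k + 1)]
  have hmono : Monotone fun k => M k * Real.exp (-S k) := by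
    refine monotone_nat_of_le_succ fun k => ?_
    have h1 : S k = 2 * r ^ k + S (k + 1) := by
      have : 1 - r ≠ 0 := by linarith
      simp only [hS]
      field_simp
      ring
    calc _ ≤ Real.exp (2 * r ^ k) * M (k + 1) * Real.exp (-S k) :=
          mul_le_mul_of_nonneg_right (hMs k) (Real.exp_pos _).le
      _ = M (k + 1) * (Real.exp (2 * r ^ k) * Real.exp (-S k)) := by ring
      _ = _ := by rw [← Real.exp_add, h1]; ring_nf
  have hlim' : Tendsto (fun k => M k * Real.exp (-S k)) atTop (𝓝 0) := by
    have h1 : Tendsto M atTop (𝓝 0) := by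
      simpa using hlim.norm.max ((tendsto_add_atTop_iff_nat 1).2 hlim).norm
    have h2 : Tendsto S atTop (𝓝 0) := by
      simpa using ((tendsto_pow_atTop_nhds_zero_of_lt_one hr0 hq2).const_mul 2).div_const (1 - r)
    simpa using h1.mul ((Real.continuous_exp.tendsto _).comp h2.neg)
  have h1 := hmono.ge_of_tendsto hlim' k
  have h2 : M k ≤ 0 := by
    by_contra h
    exact absurd h1 (not_le.2 (mul_pos (not_le.1 h) (Real.exp_pos _)))
  exact norm_le_zero_iff.1 ((le_max_left _ _).trans h2)

/-! ### The well-poised series and its recurrence -/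

/-- The terms of the well-poised side of the Göllnitz–Gordon identities. -/
noncomputable def wellPoisedTerm (q z : ℂ) (n : ℕ) : ℂ :=
  qPoch (-q) (q ^ 2) n * qPochInf (-(z * q * (q ^ 2) ^ n)) (q ^ 2) /
      (qPochInf (z * q ^ 2 * (q ^ 2) ^ n) (q ^ 2) * qPoch (q ^ 2) (q ^ 2) n) *
    ((-1) ^ n * z ^ (2 * n) * q ^ (8 * n.choose 2 + 3 * n)) *
    if n = 0 then 1 else (1 - z * ((q ^ 2) ^ n) ^ 2) / (1 - z * (q ^ 2) ^ n)

theorem one_sub_mul_pow_ne_zero {q z : ℂ} (hq : ‖q‖ < 1) (hz : ‖z‖ ≤ 1) (n : ℕ) :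
    1 - z * q ^ (n + 1) ≠ 0 := by
  intro h
  have h1 : ‖z * q ^ (n + 1)‖ < 1 := by
    rw [norm_mul]
    exact (mul_le_of_le_one_left (norm_nonneg _) hz).trans_lt (norm_pow_lt_one hq n.succ_ne_zero)
  rw [← sub_eq_zero.1 h, norm_one] at h1
  exact lt_irrefl _ h1

theorem norm_mul_pow_lt_one {q z : ℂ} (hq : ‖q‖ < 1) (hz : ‖z‖ ≤ 1) (n : ℕ) :
    ‖z * q * q ^ n‖ < 1 := by
  rw [mul_assoc, ← pow_succ', norm_mul]
  exact (mul_le_of_le_one_left (norm_nonneg _) hz).trans_lt (norm_pow_lt_one hq n.succ_ne_zero)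

/-- The telescoped partial sums of the recurrence for `wellPoisedTerm`. -/
noncomputable def wellPoisedCert (q z : ℂ) (n : ℕ) : ℂ :=
  (-1) ^ n * z ^ (2 * n + 2) * q ^ (8 * n.choose 2 + 3 * n) * ((q ^ 2) ^ n) ^ 4 * q ^ 3 *
    qPoch (-q) (q ^ 2) (n + 1) * qPochInf (-(z * q ^ 5 * (q ^ 2) ^ n)) (q ^ 2) /
      (qPochInf (z * q ^ 2 * (q ^ 2) ^ n) (q ^ 2) * qPoch (q ^ 2) (q ^ 2) n) *
    (1 + (1 + z * q) * (q ^ 2 * (q ^ 2) ^ n) - z * (q ^ 2 * (q ^ 2) ^ n) ^ 2)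

theorem sum_wellPoisedTerm_sub {q z : ℂ} (hq : ‖q‖ < 1) (hz : ‖z‖ ≤ 1) (n : ℕ) :
    ∑ i ∈ Finset.range (n + 1),
        (wellPoisedTerm q z i - (1 + z * q) * wellPoisedTerm q (z * q ^ 2) i -
          z * q ^ 2 * wellPoisedTerm q (z * q ^ 2 * q ^ 2) i) =
      wellPoisedCert q z n := by
  have hq2 := norm_pow_lt_one hq two_ne_zero
  induction n with
  | zero =>
    simp only [zero_add, Finset.range_one, Finset.sum_singleton, wellPoisedTerm, wellPoisedCert,
      qPoch_zero_right, pow_zero, mul_one, mul_zero, Nat.choose_zero_succ, if_true, one_mul,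
      qPoch_succ]
    have n1 := one_sub_mul_pow_ne_zero hq2 hz 0
    have n2 := one_sub_mul_pow_ne_zero hq2 hz 1
    have n3 : qPochInf (z * q ^ 6) (q ^ 2) ≠ 0 := by
      have := qPochInf_ne_zero_of_norm_lt hq2 (norm_mul_pow_lt_one hq2 hz 2)
      ring_nf at this ⊢
      exact this
    have e1 : qPochInf (z * q ^ 2) (q ^ 2) =
        (1 - z * q ^ 2) * ((1 - z * q ^ 4) * qPochInf (z * q ^ 6) (q ^ 2)) := by
      rw [qPochInf_eq_mul _ hq2, qPochInf_eq_mul (z * q ^ 2 * q ^ 2) hq2]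
      ring_nf
    have e2 : qPochInf (z * q ^ 2 * q ^ 2) (q ^ 2) =
        (1 - z * q ^ 4) * qPochInf (z * q ^ 6) (q ^ 2) := by
      rw [qPochInf_eq_mul (z * q ^ 2 * q ^ 2) hq2]
      ring_nf
    have e3 : z * q ^ 2 * q ^ 2 * q ^ 2 = z * q ^ 6 := by ring
    have e4 : qPochInf (-(z * q)) (q ^ 2) =
        (1 + z * q) * ((1 + z * q ^ 3) * qPochInf (-(z * q ^ 5)) (q ^ 2)) := by
      rw [qPochInf_eq_mul _ hq2, qPochInf_eq_mul (-(z * q) * q ^ 2) hq2]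
      ring_nf
    have e5 : qPochInf (-(z * q ^ 2 * q)) (q ^ 2) =
        (1 + z * q ^ 3) * qPochInf (-(z * q ^ 5)) (q ^ 2) := by
      rw [qPochInf_eq_mul _ hq2]
      ring_nf
    have e6 : z * q ^ 2 * q ^ 2 * q = z * q ^ 5 := by ring
    rw [e3, e1, e2, e4, e5, e6]
    have n4 : 1 - z * q ^ 2 ≠ 0 := by simpa using n1
    have n5 : 1 - z * q ^ 4 ≠ 0 := by rw [← pow_mul] at n2; exact n2
    field_simp
    ring
  | succ n ih =>
    rw [Finset.sum_range_succ, ih]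
    simp only [wellPoisedTerm, wellPoisedCert, Nat.succ_ne_zero, if_false]
    have hp := qPoch_ne_zero_of_norm_lt hq2 hq2 (n + 1)
    have n1 := one_sub_mul_pow_ne_zero hq2 hz n
    have n2 := one_sub_mul_pow_ne_zero hq2 hz (n + 1)
    have n3 := one_sub_mul_pow_ne_zero hq2 hz (n + 2)
    have n4 := qPochInf_ne_zero_of_norm_lt hq2 (norm_mul_pow_lt_one hq2 hz (n + 3))
    have hE : 8 * (n + 1).choose 2 + 3 * (n + 1) = 8 * n.choose 2 + 3 * n + (2 * n * 4 + 3) := by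
      rw [choose_succ_two]; ring
    rw [hE, pow_add q _ (2 * n * 4 + 3), pow_succ (-1 : ℂ) n, qPoch_succ (-q) _ (n + 1),
      show 2 * (n + 1) + 2 = 2 * n + 2 + 2 by ring, show 2 * (n + 1) = 2 * n + 2 by ring]
    rw [show q ^ (2 * n * 4 + 3) = ((q ^ 2) ^ n) ^ 4 * q ^ 3 by ring]
    rw [show (z * q ^ 2) ^ (2 * n + 2) = z ^ (2 * n + 2) * ((q ^ 2) ^ (n + 1)) ^ 2 by ring,
      show (z * q ^ 2 * q ^ 2) ^ (2 * n + 2) = z ^ (2 * n + 2) * ((q ^ 2) ^ (n + 1)) ^ 4 by ring,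
      pow_add z (2 * n + 2) 2]
    rw [qPoch_succ (q ^ 2)] at hp ⊢
    have hp1 := left_ne_zero_of_mul hp
    have hp2 := right_ne_zero_of_mul hp
    simp only [pow_succ (q ^ 2) n, pow_succ (q ^ 2) (n + 1), pow_succ (q ^ 2) (n + 2)] at n1 n2 n3 n4 hp2 ⊢
    generalize (q ^ 2) ^ n = X at *
    -- Every infinite product is reduced to one of the tails (zq⁸X;q²)_∞ and (-zq⁷X;q²)_∞, which
    -- leaves a rational identity.
    have e1 : qPochInf (z * q ^ 2 * X) (q ^ 2) = (1 - z * (X * q ^ 2)) *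
        ((1 - z * (X * q ^ 2 * q ^ 2)) * ((1 - z * (X * q ^ 2 * q ^ 2 * q ^ 2)) *
          qPochInf (z * q ^ 8 * X) (q ^ 2))) := by
      rw [qPochInf_eq_mul _ hq2, qPochInf_eq_mul (z * q ^ 2 * X * q ^ 2) hq2,
        qPochInf_eq_mul (z * q ^ 2 * X * q ^ 2 * q ^ 2) hq2]
      ring_nf
    have e2 : qPochInf (z * q ^ 2 * (X * q ^ 2)) (q ^ 2) =
        (1 - z * (X * q ^ 2 * q ^ 2)) * ((1 - z * (X * q ^ 2 * q ^ 2 * q ^ 2)) *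
          qPochInf (z * q ^ 8 * X) (q ^ 2)) := by
      rw [qPochInf_eq_mul _ hq2, qPochInf_eq_mul (z * q ^ 2 * (X * q ^ 2) * q ^ 2) hq2]
      ring_nf
    have e3 : qPochInf (z * q ^ 2 * q ^ 2 * (X * q ^ 2)) (q ^ 2) =
        (1 - z * (X * q ^ 2 * q ^ 2 * q ^ 2)) * qPochInf (z * q ^ 8 * X) (q ^ 2) := by
      rw [qPochInf_eq_mul _ hq2]
      ring_nf
    have e4 : z * q ^ 2 * q ^ 2 * q ^ 2 * (X * q ^ 2) = z * q ^ 8 * X := by ring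
    have e5 : qPochInf (-(z * q * (X * q ^ 2))) (q ^ 2) = (1 + z * q ^ 3 * X) *
        ((1 + z * q ^ 5 * X) * qPochInf (-(z * q ^ 7 * X)) (q ^ 2)) := by
      rw [qPochInf_eq_mul _ hq2, qPochInf_eq_mul (-(z * q * (X * q ^ 2)) * q ^ 2) hq2]
      ring_nf
    have e6 : qPochInf (-(z * q ^ 2 * q * (X * q ^ 2))) (q ^ 2) =
        (1 + z * q ^ 5 * X) * qPochInf (-(z * q ^ 7 * X)) (q ^ 2) := by
      rw [qPochInf_eq_mul _ hq2]
      ring_nf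
    have e7 : qPochInf (-(z * q ^ 5 * X)) (q ^ 2) =
        (1 + z * q ^ 5 * X) * qPochInf (-(z * q ^ 7 * X)) (q ^ 2) := by
      rw [qPochInf_eq_mul _ hq2]
      ring_nf
    have e8 : z * q ^ 2 * q ^ 2 * q * (X * q ^ 2) = z * q ^ 7 * X := by ring
    have e9 : z * q ^ 5 * (X * q ^ 2) = z * q ^ 7 * X := by ring
    have n5 : qPochInf (z * q ^ 8 * X) (q ^ 2) ≠ 0 := by
      convert! n4 using 2
      ring
    have d1 : 1 - z * q ^ 2 * (X * q ^ 2) = 1 - z * (X * q ^ 2 * q ^ 2) := by ring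
    have d2 : 1 - z * q ^ 2 * q ^ 2 * (X * q ^ 2) = 1 - z * (X * q ^ 2 * q ^ 2 * q ^ 2) := by ring
    rw [e4, e1, e2, e3, e5, e6, e7, e8, e9, d1, d2]
    rw [show q ^ 2 * X = X * q ^ 2 by ring] at hp2 ⊢
    generalize hP : qPoch (-q) (q ^ 2) (n + 1) = P at *
    generalize hR : qPoch (q ^ 2) (q ^ 2) n = R at *
    generalize hI : qPochInf (-(z * q ^ 7 * X)) (q ^ 2) = I at *
    generalize hJ : qPochInf (z * q ^ 8 * X) (q ^ 2) = J at *
    generalize q ^ (8 * n.choose 2 + 3 * n) = E at *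
    generalize ((-1) ^ n : ℂ) = s at *
    generalize z ^ (2 * n + 2) = Z at *
    clear hP hR hI hJ e1 e2 e3 e4 e5 e6 e7 e8 e9 d1 d2 ih hE hp n4
    generalize hA : 1 - z * (X * q ^ 2) = A at *
    generalize hB : 1 - z * (X * q ^ 2 * q ^ 2) = B at *
    generalize hC : 1 - z * (X * q ^ 2 * q ^ 2 * q ^ 2) = C at *
    generalize hD : 1 - X * q ^ 2 = D at *
    field_simp
    rw [← hA, ← hB, ← hD]
    ring

/-- The factor |z|^(2n) is kept apart from the majorant: it makes every term with n ≥ 1 vanish as k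
→ ∞. -/
theorem exists_norm_wellPoisedTerm_le {q : ℂ} (hq : ‖q‖ < 1) :
    ∃ u : ℕ → ℝ, Summable u ∧ ∀ k n : ℕ,
      ‖wellPoisedTerm q ((q ^ 2) ^ k) n‖ ≤ ‖(q ^ 2) ^ k‖ ^ (2 * n) * u n := by
  have hq2 := norm_pow_lt_one hq two_ne_zero
  obtain ⟨C, hC, hCb⟩ := exists_norm_inv_qPoch_le hq2 hq2
  obtain ⟨C', hC', hCb'⟩ := exists_norm_inv_qPochInf_le (q ^ 2) hq2
  refine ⟨fun n => Real.exp (1 / (1 - ‖q ^ 2‖)) * Real.exp (1 / (1 - ‖q ^ 2‖)) * C' * C *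
    (‖q‖ ^ n * ‖q‖ ^ n.choose 2) * (2 / (1 - ‖q ^ 2‖)),
    ((summable_pow_mul_pow_choose _ (norm_nonneg _) hq).mul_left _).mul_right _,
    fun k n => ?_⟩
  have hz := norm_pow_le_one hq2 k
  have b1 : ‖qPoch (-q) (q ^ 2) n‖ ≤ Real.exp (1 / (1 - ‖q ^ 2‖)) :=
    norm_qPoch_le hq2 (by rw [norm_neg]; exact hq.le) n
  have b2 : ‖qPochInf (-((q ^ 2) ^ k * q * (q ^ 2) ^ n)) (q ^ 2)‖ ≤
      Real.exp (1 / (1 - ‖q ^ 2‖)) := by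
    refine norm_qPochInf_le hq2 ?_
    rw [norm_neg, norm_mul, norm_mul]
    exact mul_le_one₀ (mul_le_one₀ hz (norm_nonneg _) hq.le) (norm_nonneg _)
      (norm_pow_le_one hq2 n)
  have b3 : ‖(qPochInf ((q ^ 2) ^ k * q ^ 2 * (q ^ 2) ^ n) (q ^ 2))⁻¹‖ ≤ C' := by
    rw [show (q ^ 2) ^ k * q ^ 2 * (q ^ 2) ^ n = q ^ 2 * (q ^ 2) ^ (k + n) by ring]
    exact hCb' _
  have b4 : ‖q ^ (8 * n.choose 2 + 3 * n)‖ ≤ ‖q‖ ^ n * ‖q‖ ^ n.choose 2 := by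
    rw [norm_pow, ← pow_add]
    exact pow_le_pow_of_le_one (norm_nonneg q) hq.le (by omega)
  have b5 : ‖if n = 0 then (1 : ℂ) else
      (1 - (q ^ 2) ^ k * ((q ^ 2) ^ n) ^ 2) / (1 - (q ^ 2) ^ k * (q ^ 2) ^ n)‖ ≤
      2 / (1 - ‖q ^ 2‖) := by
    have hpos : 0 < 1 - ‖q ^ 2‖ := by linarith
    split_ifs with h0
    · rw [norm_one, le_div_iff₀ hpos]
      linarith [norm_nonneg (q ^ 2)]
    · rw [norm_div]
      have c1 : ‖1 - (q ^ 2) ^ k * ((q ^ 2) ^ n) ^ 2‖ ≤ 2 := by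
        refine (norm_sub_le _ _).trans ?_
        rw [norm_one, norm_mul, ← pow_mul (q ^ 2) n 2]
        linarith [mul_le_one₀ hz (norm_nonneg _) (norm_pow_le_one hq2 (n * 2))]
      have c2 : 1 - ‖q ^ 2‖ ≤ ‖1 - (q ^ 2) ^ k * (q ^ 2) ^ n‖ := by
        have h1 := norm_sub_norm_le 1 ((q ^ 2) ^ k * (q ^ 2) ^ n)
        have h2 : ‖(q ^ 2) ^ k * (q ^ 2) ^ n‖ ≤ ‖q ^ 2‖ := by
          rw [← pow_add, norm_pow]
          exact pow_le_of_le_one (norm_nonneg _) hq2.le (by omega)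
        rw [norm_one] at h1
        linarith
      gcongr
  rw [wellPoisedTerm, norm_mul, norm_mul, norm_mul, norm_mul, div_eq_mul_inv, mul_inv, norm_mul,
    norm_mul, norm_mul, norm_pow (-1 : ℂ), norm_neg, norm_one, one_pow, one_mul,
    norm_pow _ (2 * n)]
  calc _ ≤ Real.exp (1 / (1 - ‖q ^ 2‖)) * Real.exp (1 / (1 - ‖q ^ 2‖)) * (C' * C) *
        (‖(q ^ 2) ^ k‖ ^ (2 * n) * (‖q‖ ^ n * ‖q‖ ^ n.choose 2)) * (2 / (1 - ‖q ^ 2‖)) := by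
        gcongr
        exact hCb n
    _ = _ := by ring

theorem summable_wellPoisedTerm {q : ℂ} (hq : ‖q‖ < 1) (k : ℕ) :
    Summable (wellPoisedTerm q ((q ^ 2) ^ k)) := by
  have hq2 := norm_pow_lt_one hq two_ne_zero
  obtain ⟨u, hu, h⟩ := exists_norm_wellPoisedTerm_le hq
  refine .of_norm_bounded hu.norm fun n => (h k n).trans ?_
  have h1 := pow_le_one₀ (n := 2 * n) (norm_nonneg _) (norm_pow_le_one hq2 k)
  exact (mul_le_mul_of_nonneg_left (le_abs_self _) (by positivity)).trans
    (mul_le_of_le_one_left (abs_nonneg _) h1)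

theorem tendsto_wellPoisedCert {q z : ℂ} (hq : ‖q‖ < 1) (hz : ‖z‖ ≤ 1) :
    Tendsto (wellPoisedCert q z) atTop (𝓝 0) := by
  have hq2 := norm_pow_lt_one hq two_ne_zero
  have hX := tendsto_pow_atTop_nhds_zero_of_norm_lt_one hq2
  have hcX (c : ℂ) := tendsto_mul_pow_zero c hq2
  have h0 : Tendsto (fun n : ℕ => (-1) ^ n * z ^ (2 * n + 2) * q ^ (8 * n.choose 2 + 3 * n) *
      ((q ^ 2) ^ n) ^ 4 * q ^ 3) atTop (𝓝 0) := by
    refine squeeze_zero_norm (fun n => ?_) (norm_zero (E := ℂ) ▸ hX.norm)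
    have e : (-1) ^ n * z ^ (2 * n + 2) * q ^ (8 * n.choose 2 + 3 * n) *
        ((q ^ 2) ^ n) ^ 4 * q ^ 3 = (-1) ^ n * z ^ (2 * n + 2) *
        q ^ (8 * n.choose 2 + 3 * n + 6 * n + 3) * (q ^ 2) ^ n := by ring
    have h1 : ‖z ^ (2 * n + 2)‖ ≤ 1 := by
      rw [norm_pow]; exact pow_le_one₀ (norm_nonneg _) hz
    rw [e, norm_mul, norm_mul, norm_mul, norm_pow (-1 : ℂ), norm_neg, norm_one, one_pow, one_mul]
    exact mul_le_of_le_one_left (norm_nonneg _)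
      (mul_le_one₀ h1 (norm_nonneg _) (norm_pow_le_one hq _))
  have h1 := (tendsto_add_atTop_iff_nat 1).2 (qPoch_tendsto_qPochInf (-q) hq2)
  have h2 := tendsto_qPochInf_one hq2 (by simpa using (hcX (z * q ^ 5)).neg :
    Tendsto (fun n : ℕ => -(z * q ^ 5 * (q ^ 2) ^ n)) atTop (𝓝 0))
  have h3 := tendsto_qPochInf_one hq2 (hcX (z * q ^ 2))
  have h4 := qPoch_tendsto_qPochInf (q ^ 2) hq2
  have h5 := (((hcX (q ^ 2)).const_mul (1 + z * q)).const_add 1).sub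
    (((hcX (q ^ 2)).pow 2).const_mul z)
  have hne := qPochInf_ne_zero_of_norm_lt hq2 hq2
  have := (((h0.mul h1).mul h2).div (h3.mul h4) (by simpa using hne)).mul h5
  rw [zero_mul, zero_mul, zero_div, zero_mul] at this
  exact this

theorem tsum_wellPoisedTerm_eq {q : ℂ} (hq : ‖q‖ < 1) (k : ℕ) :
    ∑' n, wellPoisedTerm q ((q ^ 2) ^ k) n =
      (1 + (q ^ 2) ^ k * q) * ∑' n, wellPoisedTerm q ((q ^ 2) ^ (k + 1)) n +
      (q ^ 2) ^ k * q ^ 2 * ∑' n, wellPoisedTerm q ((q ^ 2) ^ (k + 2)) n := by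
  have hz := norm_pow_le_one (norm_pow_lt_one hq two_ne_zero) k
  have h := (((summable_wellPoisedTerm hq k).hasSum.sub
    ((summable_wellPoisedTerm hq (k + 1)).hasSum.mul_left (1 + (q ^ 2) ^ k * q))).sub
    ((summable_wellPoisedTerm hq (k + 2)).hasSum.mul_left
      ((q ^ 2) ^ k * q ^ 2))).tendsto_sum_nat
  have h2 := tendsto_nhds_unique ((tendsto_add_atTop_iff_nat 1).2 h) <| by
    simp only [pow_succ (q ^ 2) (k + 1), pow_succ (q ^ 2) k, sum_wellPoisedTerm_sub hq hz]
    exact tendsto_wellPoisedCert hq hz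
  linear_combination h2

theorem tendsto_tsum_wellPoisedTerm {q : ℂ} (hq : ‖q‖ < 1) :
    Tendsto (fun k : ℕ => ∑' n, wellPoisedTerm q ((q ^ 2) ^ k) n) atTop (𝓝 1) := by
  have hq2 := norm_pow_lt_one hq two_ne_zero
  have hX := tendsto_pow_atTop_nhds_zero_of_norm_lt_one hq2
  obtain ⟨u, hu, h⟩ := exists_norm_wellPoisedTerm_le hq
  rw [← tsum_ite_eq (0 : ℕ) fun _ => (1 : ℂ)]
  refine tendsto_tsum_of_dominated_convergence hu.norm (fun n => ?_)
    (Eventually.of_forall fun k n => (h k n).trans ?_)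
  · rcases eq_or_ne n 0 with rfl | hn
    · have h1 := tendsto_qPochInf_one hq2 (by simpa using (hX.mul_const q).neg :
        Tendsto (fun k : ℕ => -((q ^ 2) ^ k * q)) atTop (𝓝 0))
      have h2 := tendsto_qPochInf_one hq2 (by simpa using hX.mul_const (q ^ 2) :
        Tendsto (fun k : ℕ => (q ^ 2) ^ k * q ^ 2) atTop (𝓝 0))
      have h3 := h1.div h2 one_ne_zero
      rw [div_one] at h3
      refine h3.congr fun k => ?_
      simp [wellPoisedTerm]
    · rw [if_neg hn]
      refine squeeze_zero_norm (fun k => h k n) ?_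
      simpa [hn] using ((hX.norm.pow (2 * n)).mul_const (u n))
  · have h1 := pow_le_one₀ (n := 2 * n) (norm_nonneg _) (norm_pow_le_one hq2 k)
    exact (mul_le_mul_of_nonneg_left (le_abs_self _) (by positivity)).trans
      (mul_le_of_le_one_left (abs_nonneg _) h1)

theorem tsum_gordonTerm_eq_tsum_wellPoisedTerm {q : ℂ} (hq : ‖q‖ < 1) (k : ℕ) :
    ∑' n, gordonTerm q (-q) ((q ^ 2) ^ k) n = ∑' n, wellPoisedTerm q ((q ^ 2) ^ k) n := by
  rw [← sub_eq_zero]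
  refine eq_zero_of_gordon_recurrence hq (D := fun k =>
    ∑' n, gordonTerm q (-q) ((q ^ 2) ^ k) n - ∑' n, wellPoisedTerm q ((q ^ 2) ^ k) n)
    (fun k => ?_) ?_ k
  · have h1 := tsum_gordonTerm_eq hq ((q ^ 2) ^ k)
    have h2 := tsum_wellPoisedTerm_eq hq k
    rw [← pow_succ, ← pow_succ] at h1
    linear_combination h1 - h2
  · simpa using (tendsto_tsum_gordonTerm hq (-q)).sub (tendsto_tsum_wellPoisedTerm hq)

/-! ### Evaluation of the series at z = 1 and z = q² -/

/-- The product manipulation common to both Göllnitz–Gordon identities. -/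
theorem gordon_product {q : ℂ} (hq : ‖q‖ < 1) :
    qPochInf (-q) (q ^ 2) * (qPochInf q (q ^ 8) * qPochInf (q ^ 3) (q ^ 8) *
      qPochInf (q ^ 4) (q ^ 8) * qPochInf (q ^ 5) (q ^ 8) * qPochInf (q ^ 7) (q ^ 8) *
      qPochInf (q ^ 8) (q ^ 8)) = qPochInf (q ^ 2) (q ^ 2) := by
  have hq2 := norm_pow_lt_one hq two_ne_zero
  have hq4 := norm_pow_lt_one hq (n := 4) (by norm_num)
  -- The odd residues mod 8 combine to (q;q²)_∞, which times (-q;q²)_∞ is (q²;q⁴)_∞; the residues 4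
  -- and 8 combine to (q⁴;q⁴)_∞.
  have d1 := qPochInf_dissect q hq2
  have d2 := qPochInf_dissect q hq4
  have d3 := qPochInf_dissect (q ^ 3) hq4
  have d4 := qPochInf_mul_qPochInf_neg q hq2
  have d5 := qPochInf_dissect (q ^ 2) hq2
  have d6 := qPochInf_dissect (q ^ 4) hq4
  simp only [← pow_mul, ← pow_add, ← pow_succ'] at d1 d2 d3 d4 d5 d6
  norm_num at d1 d2 d3 d4 d5 d6
  rw [d5, ← d4, d1, d2, d3, d6]
  ring

theorem wellPoisedTerm_one {q : ℂ} (hq : ‖q‖ < 1) (n : ℕ) :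
    wellPoisedTerm q 1 n = qPochInf (-q) (q ^ 2) / qPochInf (q ^ 2) (q ^ 2) *
      (thetaTerm (-q ^ 3) (-q ^ 5) n + thetaTerm (-q ^ 3) (-q ^ 5) (-n) -
        if n = 0 then 1 else 0) := by
  have hq2 := norm_pow_lt_one hq two_ne_zero
  have hP := qPochInf_ne_zero_of_norm_lt hq2 hq2
  have e8 : -q ^ 3 * -q ^ 5 = q ^ 8 := by ring
  have p1 := qPochInf_eq_qPoch_mul (-q) hq2 n
  have p2 := qPochInf_eq_qPoch_mul (q ^ 2) hq2 n
  have hp1 := left_ne_zero_of_mul (p2 ▸ hP)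
  have hp2 := right_ne_zero_of_mul (p2 ▸ hP)
  -- For n ≥ 1 the quotient is 1 + q^(2n). At n = 0 it would be 0/0; the prescribed value 1 is one
  -- less than 1 + q⁰, whence the correction.
  have hc : (if n = 0 then (1 : ℂ) else
      (1 - 1 * ((q ^ 2) ^ n) ^ 2) / (1 - 1 * (q ^ 2) ^ n)) =
      1 + (q ^ 2) ^ n - if n = 0 then 1 else 0 := by
    split_ifs with h0
    · subst h0; norm_num
    · obtain ⟨m, rfl⟩ := Nat.exists_eq_add_one_of_ne_zero h0
      rw [div_eq_iff (one_sub_mul_pow_ne_zero hq2 (by simp) m)]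
      ring
  have hd : ((-1) ^ n * 1 ^ (2 * n) * q ^ (8 * n.choose 2 + 3 * n)) *
        (1 + (q ^ 2) ^ n - if n = 0 then 1 else 0) =
      (-q ^ 3) ^ n * (q ^ 8) ^ n.choose 2 + (-q ^ 5) ^ n * (q ^ 8) ^ n.choose 2 -
        if n = 0 then 1 else 0 := by
    rw [neg_pow (q ^ 3), neg_pow (q ^ 5), one_pow]
    split_ifs with h0
    · subst h0; norm_num
    · ring
  rw [thetaTerm_neg, thetaTerm_natCast, thetaTerm_natCast, mul_comm (-q ^ 5), e8, p1, p2,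
    wellPoisedTerm, hc, mul_assoc, hd, one_mul, one_mul, neg_mul]
  field_simp

/-- After completing the products, the remaining factors reduce to 1 - q^(2n+1), whose two parts
give the theta terms of index n and -(n+1). -/
theorem wellPoisedTerm_sq {q : ℂ} (hq : ‖q‖ < 1) (n : ℕ) :
    wellPoisedTerm q (q ^ 2) n = qPochInf (-q) (q ^ 2) / qPochInf (q ^ 2) (q ^ 2) *
      (thetaTerm (-q ^ 7) (-q) n + thetaTerm (-q ^ 7) (-q) (-(n + 1))) := by
  have hq2 := norm_pow_lt_one hq two_ne_zero
  have hP := qPochInf_ne_zero_of_norm_lt hq2 hq2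
  have e8 : -q ^ 7 * -q = q ^ 8 := by ring
  have p1 := qPochInf_eq_qPoch_mul (-q) hq2 (n + 1)
  have p2 := qPochInf_eq_qPoch_mul (q ^ 2) hq2 (n + 1)
  have hp := left_ne_zero_of_mul (p2 ▸ hP)
  have hp3 := right_ne_zero_of_mul (p2 ▸ hP)
  have hc : (if n = 0 then (1 : ℂ) else
      (1 - q ^ 2 * ((q ^ 2) ^ n) ^ 2) / (1 - q ^ 2 * (q ^ 2) ^ n)) =
      (1 - q ^ 2 * ((q ^ 2) ^ n) ^ 2) / (1 - q ^ 2 * (q ^ 2) ^ n) := by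
    split_ifs with h0
    · subst h0
      have := sub_ne_zero.2 (fun h => by simp [← h] at hq2 : (1 : ℂ) ≠ q ^ 2)
      simp [this]
    · rfl
  have e1 : -(q ^ 2 * q * (q ^ 2) ^ n) = -q * (q ^ 2) ^ (n + 1) := by ring
  have e2 : q ^ 2 * q ^ 2 * (q ^ 2) ^ n = q ^ 2 * (q ^ 2) ^ (n + 1) := by ring
  rw [← Nat.cast_add_one, thetaTerm_neg, thetaTerm_natCast, thetaTerm_natCast, mul_comm (-q), e8, p1,
    p2, wellPoisedTerm, hc, e1, e2, choose_succ_two, neg_pow (q ^ 7), neg_pow q]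
  rw [qPoch_succ] at hp ⊢
  rw [qPoch_succ]
  have hp1 := left_ne_zero_of_mul hp
  have hp2 := right_ne_zero_of_mul hp
  field_simp
  ring

theorem tsum_gordonTerm_one {q : ℂ} (hq : ‖q‖ < 1) :
    ∑' n, gordonTerm q (-q) 1 n =
      1 / (qPochInf q (q ^ 8) * qPochInf (q ^ 4) (q ^ 8) * qPochInf (q ^ 7) (q ^ 8)) := by
  have hq2 := norm_pow_lt_one hq two_ne_zero
  have hq8 := norm_pow_lt_one hq (n := 8) (by norm_num)
  have hP := qPochInf_ne_zero_of_norm_lt hq2 hq2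
  have e8 : -q ^ 3 * -q ^ 5 = q ^ 8 := by ring
  have hT := (hasSum_thetaTerm (a := -q ^ 3) (b := -q ^ 5) (by rwa [e8])).nat_add_neg
  rw [e8, neg_neg, neg_neg] at hT
  -- Pairing n with -n counts the index 0 twice; the correction at n = 0 removes the surplus 1.
  have hW := (hT.sub (hasSum_ite_eq (0 : ℕ) (1 : ℂ))).mul_left
    (qPochInf (-q) (q ^ 2) / qPochInf (q ^ 2) (q ^ 2))
  simp only [← wellPoisedTerm_one hq] at hW
  have h := tsum_gordonTerm_eq_tsum_wellPoisedTerm hq 0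
  have h0 : thetaTerm (-q ^ 3) (-q ^ 5) 0 = 1 := by
    simpa using thetaTerm_natCast (-q ^ 3) (-q ^ 5) 0
  rw [pow_zero, hW.tsum_eq, h0] at h
  have hG := gordon_product hq
  rw [← hG] at hP
  simp only [mul_ne_zero_iff] at hP
  obtain ⟨h1, ⟨⟨⟨⟨⟨h2, h3⟩, h4⟩, h5⟩, h6⟩, h7⟩⟩ := hP
  rw [h, ← hG]
  field_simp
  ring

theorem tsum_gordonTerm_sq {q : ℂ} (hq : ‖q‖ < 1) :
    ∑' n, gordonTerm q (-q) (q ^ 2) n =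
      1 / (qPochInf (q ^ 3) (q ^ 8) * qPochInf (q ^ 4) (q ^ 8) * qPochInf (q ^ 5) (q ^ 8)) := by
  have hq2 := norm_pow_lt_one hq two_ne_zero
  have hq8 := norm_pow_lt_one hq (n := 8) (by norm_num)
  have hP := qPochInf_ne_zero_of_norm_lt hq2 hq2
  have e8 : -q ^ 7 * -q = q ^ 8 := by ring
  have hT := (hasSum_thetaTerm (a := -q ^ 7) (b := -q) (by rwa [e8])).nat_add_neg_add_one
  rw [e8, neg_neg, neg_neg] at hT
  have hW := hT.mul_left (qPochInf (-q) (q ^ 2) / qPochInf (q ^ 2) (q ^ 2))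
  simp only [← wellPoisedTerm_sq hq] at hW
  have h := tsum_gordonTerm_eq_tsum_wellPoisedTerm hq 1
  rw [pow_one, hW.tsum_eq] at h
  have hG := gordon_product hq
  rw [← hG] at hP
  simp only [mul_ne_zero_iff] at hP
  obtain ⟨h1, ⟨⟨⟨⟨⟨h2, h3⟩, h4⟩, h5⟩, h6⟩, h7⟩⟩ := hP
  rw [h, ← hG]
  field_simp

theorem hasSum_gordon_two {q : ℂ} (hq : ‖q‖ < 1) :
    HasSum
      (fun n : ℕ => (1 - q ^ (2 * n + 1)) * qPoch (-q ^ 3) (q ^ 2) n * q ^ (n ^ 2) /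
        qPoch (q ^ 2) (q ^ 2) n)
      (1 / (qPochInf (q ^ 3) (q ^ 8) * qPochInf (q ^ 4) (q ^ 8) * qPochInf (q ^ 5) (q ^ 8))) := by
  rw [← tsum_gordonTerm_sq hq]
  convert! tsum_gordonTerm_sub hq 1 using 1
  · ext n
    rw [gordonTerm, gordonTerm, one_mul, one_pow]
    ring
  · rw [one_mul]

theorem hasSum_gordon_one {q : ℂ} (hq : ‖q‖ < 1) (hq0 : q ≠ 0) :
    HasSum
      (fun n : ℕ => (1 - q ^ (2 * (n : ℤ) - 1)) * qPoch (-q ^ 3) (q ^ 2) n *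
        q ^ ((n : ℤ) ^ 2 - 2 * (n : ℤ)) / qPoch (q ^ 2) (q ^ 2) n)
      (1 / (qPochInf q (q ^ 8) * qPochInf (q ^ 4) (q ^ 8) * qPochInf (q ^ 7) (q ^ 8))) := by
  have e : (q ^ 2)⁻¹ * q ^ 2 = 1 := inv_mul_cancel₀ (pow_ne_zero 2 hq0)
  rw [← tsum_gordonTerm_one hq]
  -- Here z = q⁻² may lie outside the unit disc, but `tsum_gordonTerm_sub` holds for every z, and
  -- its value involves only zq² = 1.
  convert! tsum_gordonTerm_sub hq (q ^ 2)⁻¹ using 1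
  · ext n
    have e1 : q ^ (2 * (n : ℤ) - 1) = q ^ (2 * n) / q := by
      rw [zpow_sub₀ hq0, zpow_one]; norm_cast
    have e2 : q ^ ((n : ℤ) ^ 2 - 2 * (n : ℤ)) = q ^ n ^ 2 / q ^ (2 * n) := by
      rw [zpow_sub₀ hq0]; norm_cast
    rw [gordonTerm, gordonTerm, e, e1, e2, one_pow, inv_pow, ← pow_mul]
    have := pow_ne_zero (2 * n) hq0
    field_simp
  · rw [e]

theorem mainTheorem6 (q : ℂ) (hq : ‖q‖ < 1) :
    (∀ b : ℂ, b ≠ 0 →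
      HasSum
        (fun n : ℕ => qPoch b q n * qPoch (q ^ 3 / b) q n * q ^ (n * (n + 1) / 2) /
          (qPoch (q ^ 2) (q ^ 2) (n + 1) * qPoch q q n))
        (qPochInf (q ^ 4 / b) (q ^ 2) * qPochInf (b * q) (q ^ 2) / qPochInf q q)) ∧
    HasSum
      (fun n : ℕ => (1 - q ^ (2 * n + 1)) * qPoch (-q ^ 3) (q ^ 2) n * q ^ (n ^ 2) /
        qPoch (q ^ 2) (q ^ 2) n)
      (1 / (qPochInf (q ^ 3) (q ^ 8) * qPochInf (q ^ 4) (q ^ 8) * qPochInf (q ^ 5) (q ^ 8))) ∧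
    (q ≠ 0 →
      HasSum
        (fun n : ℕ => (1 - q ^ (2 * (n : ℤ) - 1)) * qPoch (-q ^ 3) (q ^ 2) n *
          q ^ ((n : ℤ) ^ 2 - 2 * (n : ℤ)) / qPoch (q ^ 2) (q ^ 2) n)
        (1 / (qPochInf q (q ^ 8) * qPochInf (q ^ 4) (q ^ 8) * qPochInf (q ^ 7) (q ^ 8)))) ∧
    Summable
      (fun n : ℕ+ => qPoch (-q) q n * q ^ (((n : ℕ) ^ 2 - (n : ℕ)) / 2) /
        qPoch q q ((n : ℕ) - 1)) ∧
    1 + ∑' n : ℕ+, qPoch (-q) q n * q ^ (((n : ℕ) ^ 2 - (n : ℕ)) / 2) /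
        qPoch q q ((n : ℕ) - 1) =
      qPochInf (-1) q *
        (qPochInf (-q ^ 6) (q ^ 16) * qPochInf (-q ^ 10) (q ^ 16) *
          qPochInf (q ^ 16) (q ^ 16)) / qPochInf (q ^ 4) (q ^ 4) ∧
    -1 + ∑' n : ℕ+, qPoch (-q) q n * q ^ (((n : ℕ) ^ 2 - (n : ℕ)) / 2) /
        qPoch q q ((n : ℕ) - 1) =
      q * (qPochInf (-1) q *
        (qPochInf (-q ^ 2) (q ^ 16) * qPochInf (-q ^ 14) (q ^ 16) *
          qPochInf (q ^ 16) (q ^ 16)) / qPochInf (q ^ 4) (q ^ 4)) := by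
  have hS := hasSum_neg_qPoch hq
  have h1 := theta_quotient_add hq
  have h2 := theta_quotient_sub hq
  refine ⟨fun b hb => hasSum_gauss_second hq hb, hasSum_gordon_two hq, hasSum_gordon_one hq,
    hS.summable, ?_, ?_⟩
  · rw [hS.tsum_eq]
    -- Half the sum of A + qB = 2S and A - qB = 2; the next identity takes half the difference.
    linear_combination -(h1 + h2) / 2
  · rw [hS.tsum_eq]
    linear_combination -(h1 - h2) / 2
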